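/- Let $d\in\{2,3\}$, let $(\Omega,P)$ be a probability space with an ergodic, measure-preserving action $\tau_x$ ($x\in\mathbb{R}^d$) such that the unitary group $(T_xf)(\omega)=f(\tau_{-x}\omega)$ on $\mathscr H_0=L^2(\Omega,P;\mathbb C)$ is strongly continuous. Let $L_i=\partial_{x_i}T_x|_{x=0}$ be its generators, with domains $\mathscr D_i$, $\mathscr D=\bigcap_i\mathscr D_i$, and let $\mathscr H=\mathscr H_0^d$ with norm $\|\cdot\|$. Put $\nabla=(L_1,\dots,L_d)^T$, $\nabla^*\zeta=-\sum_iL_i\zeta_i$, and let $\nabla\times$ be the curl built from the $L_i$, i.e. $\nabla\times\xi=(L_2\xi_3-L_3\xi_2,\,L_3\xi_1-L_1\xi_3,\,L_1\xi_2-L_2\xi_1)$ if $d=3$ and $\nabla\times\xi=L_1\xi_2-L_2\xi_1$ if $d=2$; its adjoint is $(\nabla\times)^*=\nabla\times$ if $d=3$ and $(\nabla\times)^*\varphi=(L_2\varphi,-L_1\varphi)$ if $d=2$. These expressions are applied to fields all of whose components lie in $\mathscr D$. Write $\langle\cdot\rangle$ for the average over $\Omega$, $\mathcal R(T)$ and $\mathcal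 K(T)$ for the range and kernel of $T$, and, for fields with any number of components, let $\mathscr H^1$ (resp. $\mathscr H^2_{\rm reg}$) be the set of mean-zero fields $\xi$ for which all $L_i\xi_j$ (resp. all $L_i\xi_j$ and $L_kL_i\xi_j$) exist in $L^2$. Overlines denote completion in the $L^2$ norm, i.e. closure. Let $$\mathscr H^2=\overline{\mathscr H^2_{\rm reg}},\qquad \mathscr H_\times=\overline{\mathscr H^2_{\rm reg}\cap\mathcal K(\nabla\times)},\qquad \mathscr H_\bullet=\overline{\mathscr H^2_{\rm reg}\cap\mathcal K(\nabla^*)}$$ (for $d$-component fields). Let $\Gamma=\nabla(\nabla^*\nabla)^{-1}\nabla^*$, where $\nabla^*\nabla$ has as domain the scalar fields in $\mathscr H^2_{\rm reg}$, and $\Upsilon=(\nabla\times)^*\big(\nabla\times(\nabla\times)^*\big)^{-1}\nabla\times$, where $\nabla\times(\nabla\times)^*$ has as domain the divergence-free vector fields in $\mathscr H^2_{\rm reg}$ if $d=3$ and the scalar fields in $\mathscr H^2_{\rm reg}$ if $d=2$; both $\Gamma$ and $\Upsilon$ are taken with their natural domains in $\mathscr H$. A field $E\in\mathscr H$ is weakly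 curl-free if $\langle(\nabla\times)^*\varphi,E\rangle=0$ for all $\varphi$ with components in $\mathscr D$, and $J\in\mathscr H$ is weakly divergence-free if $\langle\nabla\varphi,J\rangle=0$ for all $\varphi\in\mathscr D$. Then: 1. $\mathscr H_\times=\overline{\mathcal R(\nabla)}$ and $\mathscr H_\bullet=\overline{\mathcal R((\nabla\times)^*)}$ (so $\mathscr H_\bullet=\overline{\mathcal R(\nabla\times)}$ if $d=3$), where the operators act on $\mathscr H^2_{\rm reg}$; and $\mathscr H^2=\mathscr H_\times\oplus\mathscr H_\bullet$ orthogonally. If moreover a Poincaré inequality $\beta\|\varphi\|^2\le\|\nabla\varphi\|^2$ holds for some $\beta>0$ and all scalar $\varphi\in\mathscr H^1$, then no closure is needed: $\mathscr H_\times=\mathcal R(\nabla)$ and $\mathscr H_\bullet=\mathcal R((\nabla\times)^*)$ with the operators acting on $\mathscr H^1$. 2. The operators inverted in $\Gamma$ and $\Upsilon$ are injective, $\Gamma$ and $\Upsilon$ are densely defined in $\mathscr H$, and their closures are the orthogonal projections of $\mathscr H$ onto $\mathscr H_\times$ and $\mathscr H_\bullet$, respectively. 3. Let $\sigma$ be a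 measurable, uniformly bounded random real $d\times d$ matrix with $\sigma_0|\xi|^2\le\sigma(\omega)\xi\cdot\xi\le\sigma_0^{-1}|\xi|^2$ for some $\sigma_0>0$ and all $\omega\in\Omega$, $\xi\in\mathbb R^d$, and let $E_0\in\mathbb C^d$ be constant. There is a unique $E_f\in\mathscr H_\times$ with $\langle E_f\rangle=0$ such that $E=E_0+E_f$ satisfies, weakly, $\nabla\times E=0$, $\nabla\cdot J=0$, $J=\sigma E$, $\langle E\rangle=E_0$. Moreover $\Gamma E_0=0$ and $\Gamma E_f=E_f$ ($\Gamma$ denoting its closure in the latter). 4. Let $\rho$ be a random matrix with the same properties and $J_0\in\mathbb C^d$ constant. There is a unique $J_f\in\mathscr H_\bullet$ with $\langle J_f\rangle=0$ such that $J=J_0+J_f$ satisfies, weakly, $\nabla\times E=0$, $\nabla\cdot J=0$, $E=\rho J$, $\langle J\rangle=J_0$. Moreover $\Upsilon J_0=0$ and $\Upsilon J_f=J_f$ ($\Upsilon$ denoting its closure in the latter). -/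

import Mathlib

open MeasureTheory

noncomputable section

namespace Helmholtz

/-- The composition `g ∘ f` of partially defined operators, with its natural domain
`{x ∈ dom f | f x ∈ dom g}`. -/
def pcomp {E F G : Type*} [AddCommGroup E] [Module ℂ E] [AddCommGroup F] [Module ℂ F]
    [AddCommGroup G] [Module ℂ G] (g : F →ₗ.[ℂ] G) (f : E →ₗ.[ℂ] F) : E →ₗ.[ℂ] G where
  domain :=
    { carrier := {x | ∃ hx : x ∈ f.domain, f ⟨x, hx⟩ ∈ g.domain}
      add_mem' := by
        rintro a b ⟨ha, ha'⟩ ⟨hb, hb'⟩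
        refine ⟨f.domain.add_mem ha hb, ?_⟩
        have := g.domain.add_mem ha' hb'
        rwa [← LinearPMap.map_add] at this
      zero_mem' := by
        refine ⟨f.domain.zero_mem, ?_⟩
        have := g.domain.zero_mem
        rwa [← LinearPMap.map_zero f] at this
      smul_mem' := by
        rintro c a ⟨ha, ha'⟩
        refine ⟨f.domain.smul_mem c ha, ?_⟩
        have := g.domain.smul_mem c ha'
        rwa [← LinearPMap.map_smul] at this }
  toFun :=
    { toFun := fun x => g ⟨f ⟨x.1, x.2.1⟩, x.2.2⟩
      map_add' := fun x y => by
        rw [← LinearPMap.map_add]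
        congr 1
        exact Subtype.ext (LinearPMap.map_add f ⟨x.1, x.2.1⟩ ⟨y.1, y.2.1⟩)
      map_smul' := fun c x => by
        rw [RingHom.id_apply, ← LinearPMap.map_smul]
        congr 1
        exact Subtype.ext (LinearPMap.map_smul f c ⟨x.1, x.2.1⟩) }

/-- The range `R(T|_S)` of a partially defined operator restricted to `dom T ∩ S`. -/
def rangeOn {E F : Type*} [AddCommGroup E] [Module ℂ E] [AddCommGroup F] [Module ℂ F]
    (T : E →ₗ.[ℂ] F) (S : Submodule ℂ E) : Submodule ℂ F :=
  LinearMap.range (T.domRestrict S).toFun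

/-- The kernel `K(T)` as a subspace of the ambient space. -/
def kernel {E F : Type*} [AddCommGroup E] [Module ℂ E] [AddCommGroup F] [Module ℂ F]
    (T : E →ₗ.[ℂ] F) : Submodule ℂ E :=
  (LinearMap.ker T.toFun).map T.domain.subtype

/-- The operator `T (T' T |_S)⁻¹ T'`, with its natural domain. The inverse is the operator
`R(T' T |_S) → S`; it is meaningful when `T' T` is injective on `S`. -/
def projOp {E F : Type*} [AddCommGroup E] [Module ℂ E] [AddCommGroup F] [Module ℂ F]
    (T : E →ₗ.[ℂ] F) (T' : F →ₗ.[ℂ] E) (S : Submodule ℂ E) : F →ₗ.[ℂ] F :=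
  pcomp T (pcomp ((pcomp T' T).domRestrict S).inverse T')

section Fields

variable {Ω : Type*} [MeasurableSpace Ω] (P : Measure Ω)

/-- Random fields with `n` square integrable complex components, with the inner product
`∑ i, ⟨ξ i, ζ i⟩`. Scalar fields are the case `n = 1`. -/
abbrev Field (n : ℕ) : Type _ := PiLp 2 (fun _ : Fin n => Lp ℂ 2 P)

/-- The ensemble average of a field. -/
def mean {n : ℕ} (ξ : Field P n) : Fin n → ℂ := fun i => ∫ ω, ξ i ω ∂P

/-- The constant (deterministic) field with value `c`. -/
def constField [IsProbabilityMeasure P] {n : ℕ} (c : Fin n → ℂ) : Field P n :=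
  WithLp.toLp 2 fun i => Lp.const 2 P (c i)

/-- The fields of mean zero. -/
def meanZero [IsProbabilityMeasure P] (n : ℕ) : Submodule ℂ (Field P n) where
  carrier := {ξ | mean P ξ = 0}
  add_mem' := by
    intro a b ha hb
    have hi : ∀ f : Lp ℂ 2 P, Integrable f P := fun f =>
      (Lp.memLp f).integrable (by norm_num)
    funext i
    have h1 := congrFun ha i
    have h2 := congrFun hb i
    simp only [mean, Pi.zero_apply, PiLp.add_apply] at h1 h2 ⊢
    rw [integral_congr_ae (Lp.coeFn_add (a i) (b i))]
    simp only [Pi.add_apply]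
    rw [integral_add (hi _) (hi _), h1, h2, add_zero]
  zero_mem' := by
    funext i
    simp only [mean, Pi.zero_apply, PiLp.zero_apply]
    rw [integral_congr_ae (Lp.coeFn_zero ℂ 2 P)]
    simp
  smul_mem' := by
    intro c a ha
    funext i
    have h1 := congrFun ha i
    simp only [mean, Pi.zero_apply, PiLp.smul_apply] at h1 ⊢
    rw [integral_congr_ae (Lp.coeFn_smul c (a i))]
    simp only [Pi.smul_apply]
    rw [integral_smul, h1, smul_zero]

/-- `η = A ξ` almost surely, for a random real matrix `A`. -/
def MulEq {n : ℕ} (A : Ω → Matrix (Fin n) (Fin n) ℝ) (ξ η : Field P n) : Prop :=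
  ∀ i, (η i : Ω → ℂ) =ᵐ[P] fun ω => ∑ j, (A ω i j : ℂ) * ξ j ω

/-- A measurable, uniformly bounded random matrix `A` with
`a |ξ|² ≤ A(ω) ξ · ξ ≤ a⁻¹ |ξ|²` for some constant `a > 0`, all `ω` and all real vectors `ξ`. -/
structure IsElliptic {n : ℕ} (A : Ω → Matrix (Fin n) (Fin n) ℝ) : Prop where
  measurable : ∀ i j, Measurable fun ω => A ω i j
  bounded : ∃ K : ℝ, ∀ ω i j, |A ω i j| ≤ K
  elliptic : ∃ a : ℝ, 0 < a ∧ ∀ (ω : Ω) (ξ : Fin n → ℝ),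
    a * (ξ ⬝ᵥ ξ) ≤ (A ω).mulVec ξ ⬝ᵥ ξ ∧ (A ω).mulVec ξ ⬝ᵥ ξ ≤ a⁻¹ * (ξ ⬝ᵥ ξ)

end Fields

section Stationary

variable {Ω : Type*} [MeasurableSpace Ω] (P : Measure Ω) {d : ℕ}
  [AddAction (EuclideanSpace ℝ (Fin d)) Ω] [MeasurableConstVAdd (EuclideanSpace ℝ (Fin d)) Ω]
  [VAddInvariantMeasure (EuclideanSpace ℝ (Fin d)) Ω P]

/-- The unitary group `(T_x f)(ω) = f(τ_{-x} ω)` on `L²(Ω, P)`, where `τ_x ω = x +ᵥ ω`. -/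
def translate (x : EuclideanSpace ℝ (Fin d)) : Lp ℂ 2 P →ₗᵢ[ℂ] Lp ℂ 2 P :=
  Lp.compMeasurePreservingₗᵢ ℂ (fun ω => (-x) +ᵥ ω) (measurePreserving_vadd (-x) P)

/-- The infinitesimal generator `L_i f = ∂/∂x_i (T_x f)` at `x = 0`, the derivative being taken
in `L²(Ω, P)`, with domain `𝓓_i` consisting of all `f` for which the derivative exists. -/
def gen (i : Fin d) : Lp ℂ 2 P →ₗ.[ℂ] Lp ℂ 2 P where
  domain :=
    { carrier := {f | DifferentiableAt ℝ
        (fun t : ℝ => translate P (t • EuclideanSpace.single i (1 : ℝ)) f) 0}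
      add_mem' := by
        intro a b ha hb
        simp only [Set.mem_ofPred_eq, map_add] at ha hb ⊢
        exact ha.add hb
      zero_mem' := by simp
      smul_mem' := by
        intro c a ha
        simp only [Set.mem_ofPred_eq, map_smul] at ha ⊢
        exact ha.const_smul c }
  toFun :=
    { toFun := fun f =>
        deriv (fun t : ℝ => translate P (t • EuclideanSpace.single i (1 : ℝ)) f.1) 0
      map_add' := fun a b => by
        simp only [Submodule.coe_add, map_add]
        exact deriv_fun_add a.2 b.2
      map_smul' := fun c a => by
        simp only [Submodule.coe_smul, map_smul, RingHom.id_apply]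
        exact deriv_fun_const_smul c a.2 }

/-- The first order operator `(M ξ)_k = ∑_j (∑_i M_{kj,i} L_i) ξ_j` given by an `m × n` matrix `M`
of formal combinations of `L_1, …, L_d`; its domain consists of the fields `ξ` all of whose
components lie in `𝓓 = ⋂ i, 𝓓_i`. -/
def opMatrix {m n : ℕ} (M : Matrix (Fin m) (Fin n) (Fin d → ℂ)) :
    Field P n →ₗ.[ℂ] Field P m where
  domain :=
    { carrier := {ξ | ∀ (j : Fin n) (i : Fin d), ξ j ∈ (gen P i).domain}
      add_mem' := fun ha hb j i => (gen P i).domain.add_mem (ha j i) (hb j i)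
      zero_mem' := fun _ i => (gen P i).domain.zero_mem
      smul_mem' := fun c _ ha j i => (gen P i).domain.smul_mem c (ha j i) }
  toFun :=
    { toFun := fun ξ => WithLp.toLp 2 fun k =>
        ∑ j, ∑ i, M k j i • gen P i ⟨ξ.1 j, ξ.2 j i⟩
      map_add' := fun a b => by
        ext1 k
        simp only [PiLp.add_apply, ← Finset.sum_add_distrib, ← smul_add, ← LinearPMap.map_add]
        rfl
      map_smul' := fun c a => by
        ext1 k
        simp only [PiLp.smul_apply, RingHom.id_apply, Finset.smul_sum]
        refine Finset.sum_congr rfl fun j _ => Finset.sum_congr rfl fun i _ => ?_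
        rw [smul_comm c]
        exact congrArg (M k j i • ·) (LinearPMap.map_smul (gen P i) c ⟨a.1 j, a.2 j i⟩) }

/-- The matrix of the gradient `(L_1, …, L_d)ᵀ`. -/
def gradMatrix (d : ℕ) : Matrix (Fin d) (Fin 1) (Fin d → ℂ) :=
  Matrix.of fun i _ => Pi.single i 1

/-- The number of components of a curl: three in 3D, one in 2D. -/
def curlDim : ℕ → ℕ
  | 3 => 3
  | _ => 1

/-- The matrix of the curl, `[[0, -L₃, L₂], [L₃, 0, -L₁], [-L₂, L₁, 0]]` in 3D and `[-L₂, L₁]`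
in 2D. -/
def curlMatrix : (d : ℕ) → Matrix (Fin (curlDim d)) (Fin d) (Fin d → ℂ)
  | 3 => (!![0, -Pi.single 2 1, Pi.single 1 1;
             Pi.single 2 1, 0, -Pi.single 0 1;
             -Pi.single 1 1, Pi.single 0 1, 0] : Matrix (Fin 3) (Fin 3) (Fin 3 → ℂ))
  | 2 => (!![-Pi.single 1 1, Pi.single 0 1] : Matrix (Fin 1) (Fin 2) (Fin 2 → ℂ))
  | _ => 0

/-- The condition imposed on potentials on which `∇× (∇×)*` is inverted: divergence-free vector
potentials in 3D, no condition on the scalar potentials in 2D. -/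
def gaugeMatrix : (d : ℕ) → Matrix (Fin 1) (Fin (curlDim d)) (Fin d → ℂ)
  | 3 => -(gradMatrix 3).transpose
  | _ => 0

/-- The gradient `∇ = (L_1, …, L_d)ᵀ`. -/
def grad (d : ℕ) [AddAction (EuclideanSpace ℝ (Fin d)) Ω]
    [MeasurableConstVAdd (EuclideanSpace ℝ (Fin d)) Ω]
    [VAddInvariantMeasure (EuclideanSpace ℝ (Fin d)) Ω P] : Field P 1 →ₗ.[ℂ] Field P d :=
  opMatrix P (gradMatrix d)

/-- The adjoint `∇* ζ = -∑ i, L_i ζ_i` of the gradient. -/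
def gradAdj (d : ℕ) [AddAction (EuclideanSpace ℝ (Fin d)) Ω]
    [MeasurableConstVAdd (EuclideanSpace ℝ (Fin d)) Ω]
    [VAddInvariantMeasure (EuclideanSpace ℝ (Fin d)) Ω P] : Field P d →ₗ.[ℂ] Field P 1 :=
  opMatrix P (-(gradMatrix d).transpose)

/-- The curl `∇×`. -/
def curl (d : ℕ) [AddAction (EuclideanSpace ℝ (Fin d)) Ω]
    [MeasurableConstVAdd (EuclideanSpace ℝ (Fin d)) Ω]
    [VAddInvariantMeasure (EuclideanSpace ℝ (Fin d)) Ω P] :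
    Field P d →ₗ.[ℂ] Field P (curlDim d) :=
  opMatrix P (curlMatrix d)

/-- The adjoint `(∇×)*` of the curl (the `L_i` being skew): the curl itself in 3D, and
`φ ↦ (L₂ φ, -L₁ φ)` in 2D. -/
def curlAdj (d : ℕ) [AddAction (EuclideanSpace ℝ (Fin d)) Ω]
    [MeasurableConstVAdd (EuclideanSpace ℝ (Fin d)) Ω]
    [VAddInvariantMeasure (EuclideanSpace ℝ (Fin d)) Ω P] :
    Field P (curlDim d) →ₗ.[ℂ] Field P d :=
  opMatrix P (-(curlMatrix d).transpose)

theorem curlAdj_three [AddAction (EuclideanSpace ℝ (Fin 3)) Ω]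
    [MeasurableConstVAdd (EuclideanSpace ℝ (Fin 3)) Ω]
    [VAddInvariantMeasure (EuclideanSpace ℝ (Fin 3)) Ω P] : curlAdj P 3 = curl P 3 := by
  have h : ∀ M : Matrix (Fin 3) (Fin 3) (Fin 3 → ℂ), M = curlMatrix 3 → -M.transpose = M := by
    intro M hM
    have hM' : M = !![0, -Pi.single 2 1, Pi.single 1 1;
      Pi.single 2 1, 0, -Pi.single 0 1; -Pi.single 1 1, Pi.single 0 1, 0] := hM
    rw [hM']
    ext1 i j
    fin_cases i <;> fin_cases j <;> simp
  exact congrArg (opMatrix P (m := 3) (n := 3)) (h (curlMatrix 3) rfl)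

section Spaces

variable [IsProbabilityMeasure P] (d)

/-- The space `𝓗¹` of `n`-component fields: mean zero, all `L_i ξ_j` exist in `L²`. -/
def fieldsH1 (n : ℕ) : Submodule ℂ (Field P n) where
  carrier := {ξ | ξ ∈ meanZero P n ∧ ∀ (j : Fin n) (i : Fin d), ξ j ∈ (gen P i).domain}
  add_mem' := fun ha hb => ⟨(meanZero P n).add_mem ha.1 hb.1,
    fun j i => (gen P i).domain.add_mem (ha.2 j i) (hb.2 j i)⟩
  zero_mem' := ⟨(meanZero P n).zero_mem, fun _ i => (gen P i).domain.zero_mem⟩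
  smul_mem' := fun c _ ha => ⟨(meanZero P n).smul_mem c ha.1,
    fun j i => (gen P i).domain.smul_mem c (ha.2 j i)⟩

/-- The space `𝓗²` of `n`-component fields, before completion: mean zero, all `L_i ξ_j` and all
`L_k L_i ξ_j` exist in `L²`. -/
def fieldsH2 (n : ℕ) : Submodule ℂ (Field P n) where
  carrier := {ξ | ξ ∈ meanZero P n ∧ ∀ (j : Fin n) (i k : Fin d),
    ξ j ∈ (pcomp (gen P k) (gen P i)).domain}
  add_mem' := fun ha hb => ⟨(meanZero P n).add_mem ha.1 hb.1,
    fun j i k => Submodule.add_mem _ (ha.2 j i k) (hb.2 j i k)⟩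
  zero_mem' := ⟨(meanZero P n).zero_mem, fun _ _ _ => Submodule.zero_mem _⟩
  smul_mem' := fun c _ ha => ⟨(meanZero P n).smul_mem c ha.1,
    fun j i k => Submodule.smul_mem _ c (ha.2 j i k)⟩

/-- The Hilbert space `𝓗²`: the completion of the normed space `fieldsH2`, realized as its closure
in the space of square integrable vector fields. -/
def hilbertH2 : Submodule ℂ (Field P d) := (fieldsH2 P d d).topologicalClosure

/-- The Hilbert space `𝓗_× = 𝓗² ∩ K(∇×)` (completed in the norm of `𝓗`). -/
def curlFree : Submodule ℂ (Field P d) :=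
  (fieldsH2 P d d ⊓ kernel (curl P d)).topologicalClosure

/-- The Hilbert space `𝓗_• = 𝓗² ∩ K(∇*)` (completed in the norm of `𝓗`). -/
def divFree : Submodule ℂ (Field P d) :=
  (fieldsH2 P d d ⊓ kernel (gradAdj P d)).topologicalClosure

instance : CompleteSpace (curlFree P d) :=
  (Submodule.isClosed_topologicalClosure _).completeSpace_coe

instance : CompleteSpace (divFree P d) :=
  (Submodule.isClosed_topologicalClosure _).completeSpace_coe

/-- The potentials on which `∇× (∇×)*` is inverted: divergence-free vector fields in `𝓗²` in 3D,
scalar fields in `𝓗²` in 2D. -/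
def curlPotentials : Submodule ℂ (Field P (curlDim d)) :=
  fieldsH2 P d (curlDim d) ⊓ kernel (opMatrix P (gaugeMatrix d))

/-- `Γ = ∇ (∇* ∇)⁻¹ ∇*`. -/
def Gam : Field P d →ₗ.[ℂ] Field P d :=
  projOp (grad P d) (gradAdj P d) (fieldsH2 P d 1)

/-- `Υ = (∇×)* (∇× (∇×)*)⁻¹ ∇×`, which in 3D is `∇× (∇× ∇×)⁻¹ ∇×`. -/
def Ups : Field P d →ₗ.[ℂ] Field P d :=
  projOp (curlAdj P d) (curl P d) (curlPotentials P d)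

/-- `∇ × E = 0` weakly: `E` is orthogonal to `(∇×)* φ` for every test field `φ`. -/
def WeaklyCurlFree (E : Field P d) : Prop :=
  ∀ φ : (curlAdj P d).domain, inner ℂ (curlAdj P d φ) E = 0

/-- `∇ · J = 0` weakly: `J` is orthogonal to `∇ φ` for every test function `φ`. -/
def WeaklyDivFree (J : Field P d) : Prop :=
  ∀ φ : (grad P d).domain, inner ℂ (grad P d φ) J = 0

/-- `E` solves `∇ × E = 0`, `∇ · J = 0`, `J = σ E`, `⟨E⟩ = E₀` weakly. -/
def SolvesE (σ : Ω → Matrix (Fin d) (Fin d) ℝ) (E₀ : Fin d → ℂ) (E : Field P d) : Prop :=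
  WeaklyCurlFree P d E ∧ (∃ J : Field P d, MulEq P σ E J ∧ WeaklyDivFree P d J) ∧ mean P E = E₀

/-- `J` solves `∇ × E = 0`, `∇ · J = 0`, `E = ρ J`, `⟨J⟩ = J₀` weakly. -/
def SolvesJ (ρ : Ω → Matrix (Fin d) (Fin d) ℝ) (J₀ : Fin d → ℂ) (J : Field P d) : Prop :=
  WeaklyDivFree P d J ∧ (∃ E : Field P d, MulEq P ρ J E ∧ WeaklyCurlFree P d E) ∧ mean P J = J₀

end Spaces

end Stationary

end Helmholtz

end

noncomputable section

namespace Helmholtz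

open Filter Topology

set_option linter.unusedSectionVars false

/-! The translations form a strongly continuous unitary group whose generators `L_i` are closed,
skew and commute where the products make sense. Averaging over short segments of the axes gives
bounded operators that commute with the group, tend strongly to the identity and map every field
into the domain of all `L_k L_i`. Ergodicity says that invariant fields are constant; hence
operators commuting with the group preserve mean zero, and a mean-zero field with vanishing
derivatives is zero.

All of vector calculus is reduced to one algebraic notion, `HelmholtzPair`: two first order
operators with real constant coefficients, `B A* = 0` and `A* A + B* B = -Δ`. Integration by parts
gives `∑ ‖L_i ξ‖² = ‖A ξ‖² + ‖B ξ‖²`, so a smooth mean-zero field killed by `A` and `B` vanishes.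
The closed ranges of `A*` and `B*` are orthogonal because `B A* = 0`. They fill the mean-zero
fields: a field orthogonal to both stays so after smoothing, is then killed by `A` and `B`, and is
therefore zero (`HelmholtzPair.eq_zero_of_mem_orthogonal`). No inverse Laplacian is used.

The projection onto one range commutes with translations, hence preserves smoothness, so potentials
can be put in a gauge (`HelmholtzPair.exists_gauge`). In this gauge a Poincaré inequality controls
potentials by their images, and the ranges become closed. The operators `Γ` and `Υ` are recognised
as restrictions of orthogonal projections by reading their graphs, and density of the domain then
identifies the closure (`closure_projOp`). The electric and current fields come from Lax–Milgram on
the closed range: weak equations are exactly orthogonality to such a range. -/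

/-- A strongly continuous representation of `ℝ^d` by linear isometries. -/
structure UnitaryGroup (d : ℕ) (E : Type*) [NormedAddCommGroup E] [InnerProductSpace ℂ E] where
  /-- the isometry attached to a vector -/
  map : EuclideanSpace ℝ (Fin d) → E →ₗᵢ[ℂ] E
  map_zero : ∀ f, map 0 f = f
  map_add : ∀ x y f, map (x + y) f = map x (map y f)
  cont : ∀ f, Continuous fun x => map x f

/-! ### Isometry groups and their generators -/

namespace UnitaryGroup

variable {d : ℕ} {E F : Type*} [NormedAddCommGroup E] [InnerProductSpace ℂ E]
  [NormedAddCommGroup F] [InnerProductSpace ℂ F]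
  (U : UnitaryGroup d E) (W : UnitaryGroup d F)

/-- The one-parameter group along the `i`-th axis. -/
def ax (i : Fin d) (t : ℝ) : E →ₗᵢ[ℂ] E := U.map (t • EuclideanSpace.single i (1 : ℝ))

/-- The `i`-th generator, extended by junk outside its domain. -/
def D (i : Fin d) (f : E) : E := deriv (fun t : ℝ => U.ax i t f) 0

/-- The domain of the `i`-th generator. -/
def Dom (i : Fin d) (f : E) : Prop := DifferentiableAt ℝ (fun t : ℝ => U.ax i t f) 0

variable {U W}

theorem ax_zero (i : Fin d) (f : E) : U.ax i 0 f = f := by simp [ax, U.map_zero]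

theorem ax_add (i : Fin d) (s t : ℝ) (f : E) : U.ax i (s + t) f = U.ax i s (U.ax i t f) := by
  simp [ax, add_smul, U.map_add]

theorem ax_cont (i : Fin d) (f : E) : Continuous fun t => U.ax i t f :=
  (U.cont f).comp (by fun_prop)

theorem map_comm (x y : EuclideanSpace ℝ (Fin d)) (f : E) :
    U.map x (U.map y f) = U.map y (U.map x f) := by
  rw [← U.map_add, add_comm, U.map_add]

/-- The group law supplies the inverse `U.map (-x)`, so each isometry is unitary and its adjoint is
the inverse. -/
theorem inner_map_left (x : EuclideanSpace ℝ (Fin d)) (f g : E) :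
    inner ℂ (U.map x f) g = inner ℂ f (U.map (-x) g) := by
  conv_lhs => rw [← U.map_zero g, ← add_neg_cancel x, U.map_add]
  exact LinearIsometry.inner_map_map _ _ _

theorem inner_ax_left (i : Fin d) (t : ℝ) (f g : E) :
    inner ℂ (U.ax i t f) g = inner ℂ f (U.ax i (-t) g) := by
  rw [ax, inner_map_left, ← neg_smul, ← ax]

theorem Dom.hasDerivAt_zero {i : Fin d} {f : E} (h : U.Dom i f) :
    HasDerivAt (fun t : ℝ => U.ax i t f) (U.D i f) 0 := DifferentiableAt.hasDerivAt h

theorem dom_of_hasDerivAt {i : Fin d} {f g : E} (h : HasDerivAt (fun t : ℝ => U.ax i t f) g 0) :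
    U.Dom i f := h.differentiableAt

theorem D_of_hasDerivAt {i : Fin d} {f g : E} (h : HasDerivAt (fun t : ℝ => U.ax i t f) g 0) :
    U.D i f = g := h.deriv

/-- Differentiability at `0` is carried to time `t` by writing the orbit as `U_s f = U_t U_{s-t} f`.
-/
theorem Dom.hasDerivAt {i : Fin d} {f : E} (h : U.Dom i f) (t : ℝ) :
    HasDerivAt (fun t : ℝ => U.ax i t f) (U.ax i t (U.D i f)) t := by
  have h0 : HasDerivAt (fun s : ℝ => U.ax i s f) (U.D i f) (t - t) := by
    rw [sub_self]; exact h.hasDerivAt_zero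
  have h1 := h0.comp_sub_const t t
  have h2 := ((U.ax i t).toContinuousLinearMap.restrictScalars ℝ).hasFDerivAt.comp_hasDerivAt t h1
  refine (HasDerivAt.congr_of_eventuallyEq (f := _) h2 (Eventually.of_forall fun s => ?_))
  change U.ax i s f = U.ax i t (U.ax i (s - t) f)
  rw [← ax_add, add_sub_cancel]

theorem Dom.add {i : Fin d} {f g : E} (hf : U.Dom i f) (hg : U.Dom i g) : U.Dom i (f + g) := by
  refine dom_of_hasDerivAt (g := U.D i f + U.D i g) ?_
  simpa using! hf.hasDerivAt_zero.add hg.hasDerivAt_zero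

theorem D_add {i : Fin d} {f g : E} (hf : U.Dom i f) (hg : U.Dom i g) :
    U.D i (f + g) = U.D i f + U.D i g := by
  refine D_of_hasDerivAt ?_
  simpa using! hf.hasDerivAt_zero.add hg.hasDerivAt_zero

theorem Dom.sub {i : Fin d} {f g : E} (hf : U.Dom i f) (hg : U.Dom i g) : U.Dom i (f - g) := by
  refine dom_of_hasDerivAt (g := U.D i f - U.D i g) ?_
  simpa using! hf.hasDerivAt_zero.sub hg.hasDerivAt_zero

theorem D_sub {i : Fin d} {f g : E} (hf : U.Dom i f) (hg : U.Dom i g) :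
    U.D i (f - g) = U.D i f - U.D i g := by
  refine D_of_hasDerivAt ?_
  simpa using! hf.hasDerivAt_zero.sub hg.hasDerivAt_zero

theorem dom_zero (i : Fin d) : U.Dom i 0 := by
  simp [Dom]

variable (U W) in
/-- `B` intertwines two representations. -/
def Intertwines (B : E →L[ℂ] F) : Prop := ∀ x f, B (U.map x f) = W.map x (B f)

theorem Intertwines.hasDerivAt {B : E →L[ℂ] F} (hB : Intertwines U W B) {i : Fin d} {f : E}
    (h : U.Dom i f) : HasDerivAt (fun t : ℝ => W.ax i t (B f)) (B (U.D i f)) 0 := by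
  have := (B.restrictScalars ℝ).hasFDerivAt.comp_hasDerivAt 0 h.hasDerivAt_zero
  exact this.congr_of_eventuallyEq (Eventually.of_forall fun s => (hB _ _).symm)

theorem Intertwines.dom {B : E →L[ℂ] F} (hB : Intertwines U W B) {i : Fin d} {f : E}
    (h : U.Dom i f) : W.Dom i (B f) := dom_of_hasDerivAt (hB.hasDerivAt h)

theorem Intertwines.D {B : E →L[ℂ] F} (hB : Intertwines U W B) {i : Fin d} {f : E}
    (h : U.Dom i f) : W.D i (B f) = B (U.D i f) := D_of_hasDerivAt (hB.hasDerivAt h)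

theorem map_intertwines (x : EuclideanSpace ℝ (Fin d)) :
    Intertwines U U (U.map x).toContinuousLinearMap := fun y f => map_comm x y f

theorem Intertwines.comp {G : Type*} [NormedAddCommGroup G] [InnerProductSpace ℂ G]
    {X : UnitaryGroup d G} {B : F →L[ℂ] G} {C : E →L[ℂ] F}
    (hB : Intertwines W X B) (hC : Intertwines U W C) : Intertwines U X (B.comp C) := by
  intro x f
  simp [hC x f, hB x (C f)]

theorem Intertwines.adjoint [CompleteSpace E] [CompleteSpace F] {B : E →L[ℂ] F}
    (hB : Intertwines U W B) : Intertwines W U (ContinuousLinearMap.adjoint B) := by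
  intro x g
  refine ext_inner_left ℂ fun f => ?_
  rw [ContinuousLinearMap.adjoint_inner_right, ← neg_neg x, ← inner_map_left, ← inner_map_left,
    ContinuousLinearMap.adjoint_inner_right, hB]

/-- Skewness comes from differentiating `⟨U_t f, g⟩ = ⟨f, U_{-t} g⟩` at `0` on both sides. -/
theorem inner_D_left {i : Fin d} {f g : E} (hf : U.Dom i f) (hg : U.Dom i g) :
    inner ℂ (U.D i f) g = -inner ℂ f (U.D i g) := by
  have h1 := hf.hasDerivAt_zero.inner ℂ (hasDerivAt_const (0 : ℝ) g)
  have hg' : HasDerivAt (fun t : ℝ => U.ax i (-t) g) (-U.D i g) 0 := by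
    have h0 : HasDerivAt (fun s : ℝ => U.ax i s g) (U.D i g) (-0) := by
      rw [neg_zero]; exact hg.hasDerivAt_zero
    simpa using! h0.scomp (0 : ℝ) (hasDerivAt_neg (0 : ℝ))
  have h2 := (hasDerivAt_const (0 : ℝ) f).inner ℂ hg'
  have h3 := h1.unique (by simpa only [inner_ax_left] using h2)
  simpa [ax_zero] using h3

/-- The generator is closed: since the group is isometric, the derivatives of the orbits converge
uniformly in `t`, so limit and derivative can be exchanged. -/
theorem dom_of_tendsto [CompleteSpace E] {i : Fin d} {f : ℕ → E} {a b : E}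
    (hf : ∀ n, U.Dom i (f n)) (ha : Tendsto f atTop (𝓝 a))
    (hb : Tendsto (fun n => U.D i (f n)) atTop (𝓝 b)) :
    HasDerivAt (fun t : ℝ => U.ax i t a) b 0 := by
  have key : HasDerivAt (fun t : ℝ => U.ax i t a) (U.ax i 0 b) 0 := by
    refine hasDerivAt_of_tendstoUniformly (l := atTop) (f := fun n t => U.ax i t (f n))
      (f' := fun n t => U.ax i t (U.D i (f n))) (g' := fun t => U.ax i t b) ?_ ?_ ?_ 0
    · rw [Metric.tendstoUniformly_iff]
      intro ε hε
      filter_upwards [Metric.tendsto_nhds.1 hb ε hε] with n hn t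
      rwa [LinearIsometry.dist_map, dist_comm]
    · exact Eventually.of_forall fun n t => (hf n).hasDerivAt t
    · intro t
      exact (U.ax i t).continuous.continuousAt.tendsto.comp ha
  rwa [ax_zero] at key

theorem ax_eq_of_D_eq_zero {i : Fin d} {f : E} (hf : U.Dom i f) (h : U.D i f = 0) (t : ℝ) :
    U.ax i t f = f := by
  have := is_const_of_deriv_eq_zero (f := fun t => U.ax i t f)
    (fun t => (hf.hasDerivAt t).differentiableAt)
    (fun t => by rw [(hf.hasDerivAt t).deriv, h, LinearIsometry.map_zero]) t 0
  simpa [ax_zero] using this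

theorem map_eq_of_ax_eq {f : E} (h : ∀ i t, U.ax i t f = f) (x : EuclideanSpace ℝ (Fin d)) :
    U.map x f = f := by
  have hx : x = ∑ i, x i • EuclideanSpace.single i (1 : ℝ) := by
    ext j
    simp [Pi.single_apply]
  have : ∀ s : Finset (Fin d), U.map (∑ i ∈ s, x i • EuclideanSpace.single i (1 : ℝ)) f = f := by
    intro s
    induction s using Finset.induction_on with
    | empty => simp [U.map_zero]
    | insert a s ha ih => rw [Finset.sum_insert ha, U.map_add, ih]; exact h a _
  rw [hx]
  exact this _

/-- Difference quotients `C_n` along axis `i` commute with the group, so `D_j (C_n f) = C_n (D_j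
f)`. The right side tends to `D_i D_j f` while `C_n f` tends to `D_i f`; closedness of `D_j`
concludes. -/
theorem hasDerivAt_D_swap [CompleteSpace E] {i j : Fin d} {f : E} (hi : U.Dom i f)
    (hj : U.Dom j f) (hij : U.Dom i (U.D j f)) :
    HasDerivAt (fun t : ℝ => U.ax j t (U.D i f)) (U.D i (U.D j f)) 0 := by
  set u : ℕ → ℝ := fun n => 1 / ((n : ℝ) + 1)
  have hu : Tendsto u atTop (𝓝[≠] 0) :=
    tendsto_nhdsWithin_iff.2 ⟨tendsto_one_div_add_atTop_nhds_zero_nat,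
      Eventually.of_forall fun n => (Nat.one_div_pos_of_nat).ne'⟩
  have hC : ∀ n, Intertwines U U
      (((u n)⁻¹ : ℂ) • ((U.ax i (u n)).toContinuousLinearMap - ContinuousLinearMap.id ℂ E)) := by
    intro n x g
    simp only [ax, _root_.smul_apply, _root_.sub_apply,
      LinearIsometry.coe_toContinuousLinearMap, ContinuousLinearMap.id_apply, map_smul, map_sub,
      map_comm x]
  have hlim : ∀ g : E, U.Dom i g → Tendsto (fun n => (((u n)⁻¹ : ℂ) •
      ((U.ax i (u n)).toContinuousLinearMap - ContinuousLinearMap.id ℂ E)) g) atTop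
      (𝓝 (U.D i g)) := by
    intro g hg
    have := (hasDerivAt_iff_tendsto_slope.1 hg.hasDerivAt_zero).comp hu
    refine this.congr fun n => ?_
    simp only [Function.comp, slope_def_module, sub_zero, ax_zero,
      _root_.smul_apply, _root_.sub_apply,
      LinearIsometry.coe_toContinuousLinearMap, ContinuousLinearMap.id_apply]
    rw [← Complex.ofReal_inv, Complex.coe_smul]
  refine dom_of_tendsto (fun n => (hC n).dom hj) (hlim f hi) ?_
  refine (hlim _ hij).congr fun n => ?_
  rw [(hC n).D hj]

theorem D_comm [CompleteSpace E] {i j : Fin d} {f : E} (hi : U.Dom i f)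
    (hj : U.Dom j f) (hij : U.Dom i (U.D j f)) : U.D j (U.D i f) = U.D i (U.D j f) :=
  D_of_hasDerivAt (hasDerivAt_D_swap hi hj hij)

/-! ### Smoothing by averages along the axes -/

section Smoothing

variable (U) in
/-- The average of a vector over a segment of the `i`-th axis. -/
def avg (i : Fin d) (ε : ℝ) (hε : 0 < ε) : E →L[ℂ] E :=
  LinearMap.mkContinuous
    { toFun := fun f => (ε⁻¹ : ℂ) • ∫ s in (0 : ℝ)..ε, U.ax i s f
      map_add' := fun f g => by
        simp only [LinearIsometry.map_add]
        rw [intervalIntegral.integral_add ((ax_cont i f).intervalIntegrable _ _)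
          ((ax_cont i g).intervalIntegrable _ _), smul_add]
      map_smul' := fun c f => by
        simp only [LinearIsometry.map_smul, RingHom.id_apply]
        rw [intervalIntegral.integral_smul, smul_comm] } 1 (fun f => by
      have h := intervalIntegral.norm_integral_le_of_norm_le_const (a := 0) (b := ε)
        (f := fun s => U.ax i s f) (C := ‖f‖) (fun s _ => by simp)
      simp only [LinearMap.coe_mk, AddHom.coe_mk, norm_smul, norm_inv, Complex.norm_real,
        Real.norm_eq_abs, abs_of_pos hε, one_mul]
      rw [sub_zero, abs_of_pos hε] at h
      rw [inv_mul_le_iff₀ hε, mul_comm]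
      exact h)

theorem avg_apply (i : Fin d) (ε : ℝ) (hε : 0 < ε) (f : E) :
    U.avg i ε hε f = (ε⁻¹ : ℂ) • ∫ s in (0 : ℝ)..ε, U.ax i s f := rfl

theorem norm_avg_le (i : Fin d) (ε : ℝ) (hε : 0 < ε) : ‖U.avg i ε hε‖ ≤ 1 :=
  LinearMap.mkContinuous_norm_le _ zero_le_one _

theorem avg_intertwines [CompleteSpace E] (i : Fin d) (ε : ℝ) (hε : 0 < ε) : Intertwines U U (U.avg i ε hε) := by
  intro x f
  rw [avg_apply, avg_apply, map_smul]
  congr 1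
  have := (U.map x).toContinuousLinearMap.intervalIntegral_comp_comm (μ := volume)
    ((ax_cont (U := U) i f).intervalIntegrable 0 ε)
  simp only [LinearIsometry.coe_toContinuousLinearMap] at this
  rw [← this]
  simp only [ax, map_comm x]

theorem hasDerivAt_primitive [CompleteSpace E] (i : Fin d) (f : E) (t : ℝ) :
    HasDerivAt (fun t => ∫ s in (0 : ℝ)..t, U.ax i s f) (U.ax i t f) t :=
  intervalIntegral.integral_hasDerivAt_right ((ax_cont i f).intervalIntegrable _ _)
    ((ax_cont i f).stronglyMeasurableAtFilter _ _) (ax_cont i f).continuousAt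

/-- Translating the average by `t` shifts the segment to `[t, t + ε]`, so the orbit is a difference
of two primitives of a continuous function. -/
theorem avg_dom [CompleteSpace E] (i : Fin d) (ε : ℝ) (hε : 0 < ε) (f : E) : U.Dom i (U.avg i ε hε f) := by
  have h1 : HasDerivAt (fun t : ℝ => ∫ s in (0 : ℝ)..(t + ε), U.ax i s f)
      (U.ax i (0 + ε) f) 0 := (hasDerivAt_primitive i f (0 + ε)).comp_add_const 0 ε
  have h2 := ((h1.sub (hasDerivAt_primitive (U := U) i f 0)).const_smul (ε⁻¹ : ℂ))
  refine dom_of_hasDerivAt (h2.congr_of_eventuallyEq (Eventually.of_forall fun t => ?_))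
  simp only [avg_apply, map_smul, Pi.smul_apply, Pi.sub_apply]
  congr 1
  have := (U.ax i t).toContinuousLinearMap.intervalIntegral_comp_comm (μ := volume)
    ((ax_cont (U := U) i f).intervalIntegrable 0 ε)
  simp only [LinearIsometry.coe_toContinuousLinearMap, ← ax_add] at this
  rw [← this, intervalIntegral.integral_interval_sub_left
    ((ax_cont i f).intervalIntegrable _ _) ((ax_cont i f).intervalIntegrable _ _),
    intervalIntegral.integral_comp_add_left (fun s => U.ax i s f) t, add_zero]

theorem avg_tendsto [CompleteSpace E] (i : Fin d) (f : E) :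
    Tendsto (fun n : ℕ => U.avg i (1 / ((n : ℝ) + 1)) Nat.one_div_pos_of_nat f) atTop
      (𝓝 f) := by
  have hu : Tendsto (fun n : ℕ => 1 / ((n : ℝ) + 1)) atTop (𝓝[≠] 0) :=
    tendsto_nhdsWithin_iff.2 ⟨tendsto_one_div_add_atTop_nhds_zero_nat,
      Eventually.of_forall fun n => (Nat.one_div_pos_of_nat).ne'⟩
  have := (hasDerivAt_iff_tendsto_slope.1 (hasDerivAt_primitive (U := U) i f 0)).comp hu
  rw [ax_zero] at this
  refine this.congr fun n => ?_
  simp only [Function.comp, slope_def_module, sub_zero, intervalIntegral.integral_same, avg_apply]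
  rw [← Complex.ofReal_inv, Complex.coe_smul]

theorem tendsto_comp_of_norm_le {S R : ℕ → E →L[ℂ] E} (hS : ∀ n, ‖S n‖ ≤ 1)
    (hS' : ∀ f, Tendsto (fun n => S n f) atTop (𝓝 f))
    (hR' : ∀ f, Tendsto (fun n => R n f) atTop (𝓝 f)) (f : E) :
    Tendsto (fun n => S n (R n f)) atTop (𝓝 f) := by
  have h1 : Tendsto (fun n => S n (R n f - f)) atTop (𝓝 0) := by
    refine squeeze_zero_norm (fun n => ?_) (tendsto_iff_norm_sub_tendsto_zero.1 (hR' f))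
    exact (S n).le_of_opNorm_le (hS n) _ |>.trans (by rw [one_mul])
  have h2 := h1.add (hS' f)
  simpa using h2

variable (U) in
-- One average is composed for each axis. The new average creates the derivative along its own axis
-- and, commuting with the group, keeps those already gained.
theorem exists_smoothing_dom [CompleteSpace E] (s : Finset (Fin d)) : ∃ S : ℕ → E →L[ℂ] E, (∀ n, ‖S n‖ ≤ 1) ∧
    (∀ n, Intertwines U U (S n)) ∧ (∀ f, Tendsto (fun n => S n f) atTop (𝓝 f)) ∧
    ∀ n f, ∀ i ∈ s, U.Dom i (S n f) := by
  induction s using Finset.induction_on with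
  | empty =>
    exact ⟨fun _ => ContinuousLinearMap.id ℂ E, fun _ => ContinuousLinearMap.norm_id_le,
      fun _ x f => rfl, fun f => tendsto_const_nhds, by simp⟩
  | insert a s _ ih =>
    obtain ⟨S, h1, h2, h3, h4⟩ := ih
    refine ⟨fun n => (U.avg a (1 / ((n : ℝ) + 1)) Nat.one_div_pos_of_nat).comp (S n),
      fun n => ?_, fun n => (avg_intertwines _ _ _).comp (h2 n), fun f => ?_, fun n f i hi => ?_⟩
    · exact (ContinuousLinearMap.opNorm_comp_le _ _).trans
        (mul_le_one₀ (norm_avg_le _ _ _) (norm_nonneg _) (h1 n))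
    · exact tendsto_comp_of_norm_le (fun n => norm_avg_le _ _ _) (avg_tendsto a) h3 f
    · rcases Finset.mem_insert.1 hi with rfl | hi
      · exact avg_dom _ _ Nat.one_div_pos_of_nat _
      · exact (avg_intertwines _ _ Nat.one_div_pos_of_nat).dom (h4 n f i hi)

variable (U) in
/-- Smoothing operators: they commute with the representation, converge strongly to the identity
and map into the domain of all products of two generators. -/
theorem exists_smoothing [CompleteSpace E] : ∃ S : ℕ → E →L[ℂ] E,
    (∀ n, Intertwines U U (S n)) ∧ (∀ f, Tendsto (fun n => S n f) atTop (𝓝 f)) ∧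
    ∀ n f i, U.Dom i (S n f) ∧ ∀ k, U.Dom k (U.D i (S n f)) := by
  obtain ⟨S, h1, h2, h3, h4⟩ := U.exists_smoothing_dom Finset.univ
  -- Using `S` twice gives two derivatives: `D_i` passes through the outer copy, leaving a vector in
  -- the range of `S`, which lies in every domain.
  refine ⟨fun n => (S n).comp (S n), fun n => (h2 n).comp (h2 n),
    fun f => tendsto_comp_of_norm_le h1 h3 h3 f, fun n f i => ⟨h4 n _ i (Finset.mem_univ _),
    fun k => ?_⟩⟩
  rw [ContinuousLinearMap.comp_apply, (h2 n).D (h4 n f i (Finset.mem_univ _))]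
  exact h4 n _ k (Finset.mem_univ _)

end Smoothing

/-- The orthogonal projection onto an invariant subspace commutes with the representation. -/
theorem starProjection_intertwines [CompleteSpace E] {K : Submodule ℂ E}
    [K.HasOrthogonalProjection]
    (hK : ∀ x, ∀ f ∈ K, U.map x f ∈ K) : Intertwines U U K.starProjection := by
  intro x f
  -- The translate of the projection lies in `K`, and the translated remainder is still orthogonal
  -- to `K` because `K` is invariant under the inverse translation.
  refine (Submodule.eq_starProjection_of_mem_orthogonal
    (hK x _ (K.starProjection_apply_mem f)) ?_)
  rw [Submodule.mem_orthogonal]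
  intro g hg
  rw [← map_sub, ← neg_neg x, ← inner_map_left]
  exact (Submodule.mem_orthogonal _ _).1 (K.sub_starProjection_mem_orthogonal f) _ (hK _ _ hg)

end UnitaryGroup

open UnitaryGroup

/-! ### Translations of random fields, mean zero and ergodicity -/

section Stationary

variable {Ω : Type*} [MeasurableSpace Ω] {P : Measure Ω} {d : ℕ}
  [AddAction (EuclideanSpace ℝ (Fin d)) Ω] [MeasurableConstVAdd (EuclideanSpace ℝ (Fin d)) Ω]

section Translate

variable [VAddInvariantMeasure (EuclideanSpace ℝ (Fin d)) Ω P]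

theorem coeFn_translate (x : EuclideanSpace ℝ (Fin d)) (f : Lp ℂ 2 P) :
    (translate P x f : Ω → ℂ) =ᵐ[P] fun ω => f (-x +ᵥ ω) :=
  Lp.coeFn_compMeasurePreserving f (measurePreserving_vadd (-x) P)

theorem translate_zero (f : Lp ℂ 2 P) : translate P (0 : EuclideanSpace ℝ (Fin d)) f = f := by
  refine Lp.ext ((coeFn_translate 0 f).trans ?_)
  simp

theorem translate_add (x y : EuclideanSpace ℝ (Fin d)) (f : Lp ℂ 2 P) :
    translate P (x + y) f = translate P x (translate P y f) := by
  refine Lp.ext ((coeFn_translate _ f).trans ?_)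
  have h1 := (measurePreserving_vadd (-x) P).quasiMeasurePreserving.ae_eq_comp
    (coeFn_translate y f)
  refine EventuallyEq.symm ((coeFn_translate x _).trans (h1.trans ?_))
  refine Eventually.of_forall fun ω => ?_
  simp only [Function.comp, ← add_vadd]
  rw [neg_add_rev]

variable (P) in
/-- The translations of `L²(Ω, P)` as a strongly continuous group. -/
def scalarGroup (hcont : ∀ f : Lp ℂ 2 P,
    Continuous fun x : EuclideanSpace ℝ (Fin d) => translate P x f) :
    UnitaryGroup d (Lp ℂ 2 P) where
  map := translate P
  map_zero := translate_zero
  map_add := translate_add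
  cont := hcont

variable (P) in
/-- The translations of fields with `n` components, acting componentwise. -/
def fieldGroup (hcont : ∀ f : Lp ℂ 2 P,
    Continuous fun x : EuclideanSpace ℝ (Fin d) => translate P x f) (n : ℕ) :
    UnitaryGroup d (Field P n) where
  map x :=
    { toFun := fun ξ => WithLp.toLp 2 fun j => translate P x (ξ j)
      map_add' := fun ξ ζ => by ext1 j; simp
      map_smul' := fun c ξ => by ext1 j; simp
      norm_map' := fun ξ => by simp [PiLp.norm_eq_of_L2] }
  map_zero ξ := by ext1 j; simp [translate_zero]
  map_add x y ξ := by ext1 j; simp [translate_add]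
  cont ξ := by
    refine (PiLp.continuous_toLp 2 _).comp (continuous_pi fun j => hcont (ξ j))

end Translate

section Constants

variable [IsProbabilityMeasure P]

theorem inner_constField {n : ℕ} (c : Fin n → ℂ) (ξ : Field P n) :
    inner ℂ (constField P c) ξ = ∑ i, starRingEnd ℂ (c i) * mean P ξ i := by
  rw [PiLp.inner_apply]
  refine Finset.sum_congr rfl fun i _ => ?_
  rw [L2.inner_def]
  simp only [constField, mean]
  rw [← integral_const_mul]
  refine integral_congr_ae ?_
  filter_upwards [Lp.coeFn_const 2 P (c i)] with ω hω
  rw [hω]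
  simp [mul_comm]

theorem mem_meanZero {n : ℕ} {ξ : Field P n} : ξ ∈ meanZero P n ↔ mean P ξ = 0 := Iff.rfl

/-- Mean zero is recast as orthogonality to the constant fields, so that adjoints and continuity of
the inner product apply. -/
theorem mem_meanZero_iff {n : ℕ} {ξ : Field P n} :
    ξ ∈ meanZero P n ↔ ∀ c : Fin n → ℂ, inner ℂ (constField P c) ξ = 0 := by
  rw [mem_meanZero]
  constructor
  · intro h c
    rw [inner_constField, h]
    simp
  · intro h
    funext i
    have := h (Pi.single i 1)
    rw [inner_constField, Finset.sum_eq_single i] at this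
    · simpa using this
    · intro j _ hj
      simp [hj]
    · simp

theorem isClosed_meanZero (n : ℕ) : IsClosed (meanZero P n : Set (Field P n)) := by
  have : (meanZero P n : Set (Field P n)) =
      ⋂ c : Fin n → ℂ, {ξ | inner ℂ (constField P c) ξ = 0} := by
    ext ξ
    simp only [SetLike.mem_coe, mem_meanZero_iff, Set.mem_iInter]
    rfl
  rw [this]
  exact isClosed_iInter fun c => isClosed_eq (by fun_prop) continuous_const

theorem mean_constField {n : ℕ} (c : Fin n → ℂ) : mean P (constField P c) = c := by
  funext i
  simp only [mean, constField]
  rw [integral_congr_ae (Lp.coeFn_const 2 P (c i))]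
  simp

theorem mean_add {n : ℕ} (ξ ζ : Field P n) : mean P (ξ + ζ) = mean P ξ + mean P ζ := by
  funext i
  have hi : ∀ f : Lp ℂ 2 P, Integrable f P := fun f => (Lp.memLp f).integrable (by norm_num)
  simp only [mean, Pi.add_apply, PiLp.add_apply]
  rw [integral_congr_ae (Lp.coeFn_add (ξ i) (ζ i))]
  exact integral_add (hi _) (hi _)

theorem sub_constField_mem {n : ℕ} (ξ : Field P n) :
    ξ - constField P (mean P ξ) ∈ meanZero P n := by
  rw [mem_meanZero]
  have := mean_add (ξ - constField P (mean P ξ)) (constField P (mean P ξ))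
  rw [sub_add_cancel, mean_constField] at this
  simpa using this.symm

end Constants

section Ergodic

variable [IsProbabilityMeasure P] [ErgodicVAdd (EuclideanSpace ℝ (Fin d)) Ω P]

/-- Preimages under `f` of measurable sets are invariant up to null sets under each translation,
hence null or conull by ergodicity. Measurable sets of `ℂ` being countably separated, `f` is
constant almost everywhere. -/
theorem eq_const_of_translate_eq {f : Lp ℂ 2 P}
    (hf : ∀ x : EuclideanSpace ℝ (Fin d), translate P x f = f) :
    ∃ c : ℂ, f = Lp.const 2 P c := by
  have hm : Measurable (f : Ω → ℂ) := (Lp.stronglyMeasurable f).measurable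
  obtain ⟨c, hc⟩ : ∃ c, (f : Ω → ℂ) =ᵐ[P] Function.const Ω c := by
    refine Filter.exists_eventuallyEq_const_of_forall_separating MeasurableSet fun U hU => ?_
    have h := aeconst_of_forall_preimage_vadd_ae_eq (EuclideanSpace ℝ (Fin d))
      (hm hU).nullMeasurableSet (s := (f : Ω → ℂ) ⁻¹' U) (μ := P) (fun g => ?_)
    · rcases Filter.eventuallyConst_set.1 h with h | h
      · exact Or.inl h
      · exact Or.inr h
    · have := coeFn_translate (-g) f
      rw [hf, neg_neg] at this
      filter_upwards [this] with ω hω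
      apply propext
      change f (g +ᵥ ω) ∈ U ↔ f ω ∈ U
      rw [hω]
  exact ⟨c, Lp.ext (hc.trans (Lp.coeFn_const 2 P c).symm)⟩

variable {hcont : ∀ f : Lp ℂ 2 P, Continuous fun x : EuclideanSpace ℝ (Fin d) => translate P x f}

theorem fieldGroup_map_apply {n : ℕ} (x : EuclideanSpace ℝ (Fin d)) (ξ : Field P n) (j : Fin n) :
    (fieldGroup P hcont n).map x ξ j = translate P x (ξ j) := rfl

theorem eq_constField_of_map_eq {n : ℕ} {ξ : Field P n}
    (hξ : ∀ x, (fieldGroup P hcont n).map x ξ = ξ) : ∃ c, ξ = constField P c := by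
  have : ∀ j, ∃ c, ξ j = Lp.const 2 P c := fun j =>
    eq_const_of_translate_eq fun x => by rw [← fieldGroup_map_apply (hcont := hcont), hξ]
  choose c hc using this
  exact ⟨c, by ext1 j; exact hc j⟩

theorem map_constField {n : ℕ} (x : EuclideanSpace ℝ (Fin d)) (c : Fin n → ℂ) :
    (fieldGroup P hcont n).map x (constField P c) = constField P c := by
  ext1 j
  rw [fieldGroup_map_apply]
  refine Lp.ext ((coeFn_translate x _).trans ?_)
  have := (measurePreserving_vadd (-x) P).quasiMeasurePreserving.ae_eq_comp
    (Lp.coeFn_const 2 P (c j))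
  exact this.trans (Lp.coeFn_const 2 P (c j)).symm

theorem hasDerivAt_constField {n : ℕ} (c : Fin n → ℂ) (i : Fin d) :
    HasDerivAt (fun t : ℝ => (fieldGroup P hcont n).ax i t (constField P c)) 0 0 := by
  simp only [ax, map_constField]
  exact hasDerivAt_const _ _

/-- The adjoint also commutes with translations, so it sends constant fields to invariant ones,
which are constant by ergodicity. Orthogonality to constants is therefore preserved. -/
theorem meanZero_of_intertwines {m n : ℕ} {B : Field P m →L[ℂ] Field P n}
    (hB : Intertwines (fieldGroup P hcont m) (fieldGroup P hcont n) B) {ξ : Field P m}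
    (hξ : ξ ∈ meanZero P m) : B ξ ∈ meanZero P n := by
  rw [mem_meanZero_iff] at hξ ⊢
  intro c
  obtain ⟨c', hc'⟩ : ∃ c', ContinuousLinearMap.adjoint B (constField P c) = constField P c' :=
    eq_constField_of_map_eq (hcont := hcont) fun x => by rw [← hB.adjoint, map_constField]
  rw [← ContinuousLinearMap.adjoint_inner_left, hc']
  exact hξ c'

theorem meanZero_D {n : ℕ} {ξ : Field P n} {i : Fin d} (h : (fieldGroup P hcont n).Dom i ξ) :
    (fieldGroup P hcont n).D i ξ ∈ meanZero P n := by
  rw [mem_meanZero_iff]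
  intro c
  have h0 := hasDerivAt_constField (hcont := hcont) c i
  have := inner_D_left (dom_of_hasDerivAt h0) h
  rw [D_of_hasDerivAt h0, inner_zero_left] at this
  simpa using this.symm

/-- Vanishing derivatives make the field invariant along each axis, hence under all translations,
hence constant; the mean identifies the constant as `0`. -/
theorem eq_zero_of_D_eq_zero {n : ℕ} {ξ : Field P n} (h0 : ξ ∈ meanZero P n)
    (h : ∀ i, (fieldGroup P hcont n).Dom i ξ) (h' : ∀ i, (fieldGroup P hcont n).D i ξ = 0) :
    ξ = 0 := by
  obtain ⟨c, rfl⟩ := eq_constField_of_map_eq (hcont := hcont)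
    (map_eq_of_ax_eq fun i t => ax_eq_of_D_eq_zero (h i) (h' i) t)
  rw [mem_meanZero, mean_constField] at h0
  subst h0
  ext1 j
  simp [constField]

/-- The `j`-th component of a field. -/
def proj (P : Measure Ω) {n : ℕ} (j : Fin n) : Field P n →L[ℂ] Lp ℂ 2 P :=
  PiLp.proj 2 (fun _ : Fin n => Lp ℂ 2 P) j

theorem proj_intertwines {n : ℕ} (j : Fin n) :
    Intertwines (fieldGroup P hcont n) (scalarGroup P hcont) (proj P j) := fun _ _ => rfl

theorem gen_apply {i : Fin d} {f : Lp ℂ 2 P} (hf : f ∈ (gen P i).domain) :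
    gen P i ⟨f, hf⟩ = (scalarGroup P hcont).D i f := rfl

theorem hasDerivAt_field {n : ℕ} {i : Fin d} {ξ : Field P n}
    (h : ∀ j, (scalarGroup P hcont).Dom i (ξ j)) :
    HasDerivAt (fun t : ℝ => (fieldGroup P hcont n).ax i t ξ)
      (WithLp.toLp 2 fun j => (scalarGroup P hcont).D i (ξ j)) 0 := by
  have h1 : HasDerivAt (fun (t : ℝ) (j : Fin n) => (scalarGroup P hcont).ax i t (ξ j))
      (fun j => (scalarGroup P hcont).D i (ξ j)) 0 :=
    hasDerivAt_pi.2 fun j => (h j).hasDerivAt_zero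
  exact ((PiLp.continuousLinearEquiv 2 ℝ
    (fun _ : Fin n => Lp ℂ 2 P)).symm.toContinuousLinearMap.hasFDerivAt).comp_hasDerivAt 0 h1

theorem field_dom_iff {n : ℕ} {i : Fin d} {ξ : Field P n} :
    (fieldGroup P hcont n).Dom i ξ ↔ ∀ j, ξ j ∈ (gen P i).domain :=
  ⟨fun h j => (proj_intertwines j).dom h, fun h => dom_of_hasDerivAt (hasDerivAt_field h)⟩

theorem field_D_apply {n : ℕ} {i : Fin d} {ξ : Field P n} (h : (fieldGroup P hcont n).Dom i ξ)
    (j : Fin n) : (fieldGroup P hcont n).D i ξ j = (scalarGroup P hcont).D i (ξ j) :=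
  ((proj_intertwines j).D h).symm

theorem mem_fieldsH1_iff {n : ℕ} {ξ : Field P n} :
    ξ ∈ fieldsH1 P d n ↔ ξ ∈ meanZero P n ∧ ∀ i, (fieldGroup P hcont n).Dom i ξ := by
  simp only [field_dom_iff]
  exact and_congr Iff.rfl forall_comm

theorem mem_fieldsH2_iff {n : ℕ} [NeZero d] {ξ : Field P n} :
    ξ ∈ fieldsH2 P d n ↔ ξ ∈ meanZero P n ∧ ∀ i, (fieldGroup P hcont n).Dom i ξ ∧
      ∀ k, (fieldGroup P hcont n).Dom k ((fieldGroup P hcont n).D i ξ) := by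
  refine and_congr Iff.rfl ⟨fun h i => ?_, fun h j i k => ?_⟩
  -- The first derivative is recorded only through some product `L_k L_i`; taking `k = 0` is where
  -- `d ≠ 0` enters.
  · have h1 : (fieldGroup P hcont n).Dom i ξ := field_dom_iff.2 fun j => (h j i 0).1
    refine ⟨h1, fun k => field_dom_iff.2 fun j => ?_⟩
    rw [field_D_apply h1]
    exact (h j i k).2
  · refine ⟨field_dom_iff.1 (h i).1 j, ?_⟩
    have := field_dom_iff.1 ((h i).2 k) j
    rwa [field_D_apply (h i).1] at this

end Ergodic

end Stationary

/-! ### Symbols of first order operators -/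

section Symbols

variable {Ω : Type*} [MeasurableSpace Ω] {P : Measure Ω} {d : ℕ}

variable (P) in
/-- A constant matrix acting on fields. -/
def cmap {m n : ℕ} (A : Matrix (Fin m) (Fin n) ℂ) : Field P n →L[ℂ] Field P m :=
  (PiLp.continuousLinearEquiv 2 ℂ (fun _ : Fin m => Lp ℂ 2 P)).symm.toContinuousLinearMap.comp
    (ContinuousLinearMap.pi fun k => ∑ j, A k j • proj P j)

theorem cmap_apply {m n : ℕ} (A : Matrix (Fin m) (Fin n) ℂ) (ξ : Field P n) (k : Fin m) :
    cmap P A ξ k = ∑ j, A k j • ξ j := by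
  simp [cmap]
  rfl

theorem cmap_mul {l m n : ℕ} (A : Matrix (Fin l) (Fin m) ℂ) (B : Matrix (Fin m) (Fin n) ℂ)
    (ξ : Field P n) : cmap P A (cmap P B ξ) = cmap P (A * B) ξ := by
  ext1 k
  simp only [cmap_apply, Matrix.mul_apply, Finset.smul_sum, Finset.sum_smul, smul_smul]
  exact Finset.sum_comm

theorem cmap_add {m n : ℕ} (A B : Matrix (Fin m) (Fin n) ℂ) (ξ : Field P n) :
    cmap P (A + B) ξ = cmap P A ξ + cmap P B ξ := by
  ext1 k
  simp [cmap_apply, add_smul, Finset.sum_add_distrib]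

theorem cmap_neg {m n : ℕ} (A : Matrix (Fin m) (Fin n) ℂ) (ξ : Field P n) :
    cmap P (-A) ξ = -cmap P A ξ := by
  ext1 k
  simp [cmap_apply]

theorem cmap_zero {m n : ℕ} (ξ : Field P n) :
    cmap P (0 : Matrix (Fin m) (Fin n) ℂ) ξ = 0 := by
  ext1 k
  simp [cmap_apply]

theorem cmap_two {n : ℕ} (ξ : Field P n) :
    cmap P (2 : Matrix (Fin n) (Fin n) ℂ) ξ = ξ + ξ := by
  have h1 : cmap P (1 : Matrix (Fin n) (Fin n) ℂ) ξ = ξ := by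
    ext1 k
    rw [cmap_apply, Finset.sum_eq_single k]
    · rw [Matrix.one_apply_eq, one_smul]
    · intro j _ hj
      rw [Matrix.one_apply_ne hj.symm, zero_smul]
    · simp
  have h2 : (2 : Matrix (Fin n) (Fin n) ℂ) = 1 + 1 := one_add_one_eq_two.symm
  rw [h2, cmap_add, h1]

theorem inner_cmap_left {m n : ℕ} (A : Matrix (Fin m) (Fin n) ℂ) (ξ : Field P n) (ζ : Field P m) :
    inner ℂ (cmap P A ξ) ζ = inner ℂ ξ (cmap P A.conjTranspose ζ) := by
  simp only [PiLp.inner_apply, cmap_apply, sum_inner, inner_sum, inner_smul_left, inner_smul_right,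
    Matrix.conjTranspose_apply]
  exact Finset.sum_comm

/-- The matrix of coefficients of `L_i` in a first order operator. -/
def slice {m n : ℕ} (M : Matrix (Fin m) (Fin n) (Fin d → ℂ)) (i : Fin d) :
    Matrix (Fin m) (Fin n) ℂ := M.map fun v => v i

/-- The operators with matrices `A` and `B` have real coefficients, `B A* = 0` and
`A* A + B* B = -Δ`. -/
structure HelmholtzPair {a b n : ℕ} (A : Matrix (Fin a) (Fin n) (Fin d → ℂ))
    (B : Matrix (Fin b) (Fin n) (Fin d → ℂ)) : Prop where
  real_left : ∀ i, (slice A i).conjTranspose = (slice A i).transpose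
  real_right : ∀ i, (slice B i).conjTranspose = (slice B i).transpose
  -- Since `L_k L_i = L_i L_k` on smooth fields, only the part of the coefficients symmetric in `i,
  -- k` matters. Both identities are symmetrised, which is why the Laplacian has `2` on the
  -- diagonal.
  comp_eq_zero : ∀ i k,
    slice B k * (slice A i).transpose + slice B i * (slice A k).transpose = 0
  laplacian : ∀ i k, (slice A k).transpose * slice A i + (slice A i).transpose * slice A k +
    ((slice B k).transpose * slice B i + (slice B i).transpose * slice B k) = if i = k then 2 else 0

theorem HelmholtzPair.symm {a b n : ℕ} {A : Matrix (Fin a) (Fin n) (Fin d → ℂ)}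
    {B : Matrix (Fin b) (Fin n) (Fin d → ℂ)} (h : HelmholtzPair A B) : HelmholtzPair B A where
  real_left := h.real_right
  real_right := h.real_left
  comp_eq_zero i k := by
    have := congrArg Matrix.transpose (h.comp_eq_zero k i)
    simpa [Matrix.transpose_add, Matrix.transpose_mul] using this
  laplacian i k := by
    rw [add_comm]
    exact h.laplacian i k

theorem slice_neg_transpose {m n : ℕ} (M : Matrix (Fin m) (Fin n) (Fin d → ℂ)) (i : Fin d) :
    slice (-M.transpose) i = -(slice M i).transpose := rfl

end Symbols

/-! ### Integration by parts and the energy identity -/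

section Operators

variable {Ω : Type*} [MeasurableSpace Ω] {P : Measure Ω} {d : ℕ}
  [AddAction (EuclideanSpace ℝ (Fin d)) Ω] [MeasurableConstVAdd (EuclideanSpace ℝ (Fin d)) Ω]
  [IsProbabilityMeasure P] [ErgodicVAdd (EuclideanSpace ℝ (Fin d)) Ω P]
  {hcont : ∀ f : Lp ℂ 2 P, Continuous fun x : EuclideanSpace ℝ (Fin d) => translate P x f}
  {a b l m n : ℕ}

theorem cmap_intertwines (A : Matrix (Fin m) (Fin n) ℂ) :
    Intertwines (fieldGroup P hcont n) (fieldGroup P hcont m) (cmap P A) := by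
  intro x ξ
  ext1 k
  simp [cmap_apply, fieldGroup_map_apply]

variable (P) in
/-- An operator on scalar fields acting componentwise. -/
def lift (n : ℕ) (S : Lp ℂ 2 P →L[ℂ] Lp ℂ 2 P) : Field P n →L[ℂ] Field P n :=
  (PiLp.continuousLinearEquiv 2 ℂ (fun _ : Fin n => Lp ℂ 2 P)).symm.toContinuousLinearMap.comp
    (ContinuousLinearMap.pi fun k => S.comp (proj P k))

theorem lift_apply (S : Lp ℂ 2 P →L[ℂ] Lp ℂ 2 P) (ξ : Field P n) (k : Fin n) :
    lift P n S ξ k = S (ξ k) := rfl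

theorem lift_intertwines {S : Lp ℂ 2 P →L[ℂ] Lp ℂ 2 P}
    (hS : Intertwines (scalarGroup P hcont) (scalarGroup P hcont) S) :
    Intertwines (fieldGroup P hcont n) (fieldGroup P hcont n) (lift P n S) := by
  intro x ξ
  ext1 k
  exact hS x (ξ k)

theorem inner_lift_left (S : Lp ℂ 2 P →L[ℂ] Lp ℂ 2 P) (ξ ζ : Field P n) :
    inner ℂ (lift P n S ξ) ζ = inner ℂ ξ (lift P n (ContinuousLinearMap.adjoint S) ζ) := by
  simp [PiLp.inner_apply, lift_apply, ContinuousLinearMap.adjoint_inner_right]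

theorem lift_cmap (S : Lp ℂ 2 P →L[ℂ] Lp ℂ 2 P) (A : Matrix (Fin m) (Fin n) ℂ) (ξ : Field P n) :
    lift P m S (cmap P A ξ) = cmap P A (lift P n S ξ) := by
  ext1 k
  simp [lift_apply, cmap_apply]

theorem tendsto_lift {S : ℕ → Lp ℂ 2 P →L[ℂ] Lp ℂ 2 P}
    (hS : ∀ f, Tendsto (fun n => S n f) atTop (𝓝 f)) (ξ : Field P n) :
    Tendsto (fun k => lift P n (S k) ξ) atTop (𝓝 ξ) :=
  ((PiLp.continuous_toLp 2 (fun _ : Fin n => Lp ℂ 2 P)).tendsto _).comp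
    (tendsto_pi_nhds.2 fun j => hS (ξ j))

variable (hcont) in
/-- A field in the domain of all generators. -/
def Smooth1 {n : ℕ} (ξ : Field P n) : Prop := ∀ i, (fieldGroup P hcont n).Dom i ξ

variable (hcont) in
/-- A field in the domain of all products of two generators. -/
def Smooth2 {n : ℕ} (ξ : Field P n) : Prop := ∀ i, (fieldGroup P hcont n).Dom i ξ ∧
  ∀ k, (fieldGroup P hcont n).Dom k ((fieldGroup P hcont n).D i ξ)

variable (hcont) in
/-- The first order operator with matrix `M`, extended by junk outside its domain. -/
def op (M : Matrix (Fin m) (Fin n) (Fin d → ℂ)) (ξ : Field P n) : Field P m :=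
  ∑ i, cmap P (slice M i) ((fieldGroup P hcont n).D i ξ)

theorem Smooth2.smooth1 {ξ : Field P n} (h : Smooth2 hcont ξ) : Smooth1 hcont ξ := fun i => (h i).1

theorem Smooth1.sub {ξ ζ : Field P n} (h : Smooth1 hcont ξ) (h' : Smooth1 hcont ζ) :
    Smooth1 hcont (ξ - ζ) := fun i => (h i).sub (h' i)

theorem Smooth1.of_intertwines {B : Field P m →L[ℂ] Field P n}
    (hB : Intertwines (fieldGroup P hcont m) (fieldGroup P hcont n) B) {ξ : Field P m}
    (h : Smooth1 hcont ξ) : Smooth1 hcont (B ξ) := fun i => hB.dom (h i)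

theorem Smooth2.of_intertwines {B : Field P m →L[ℂ] Field P n}
    (hB : Intertwines (fieldGroup P hcont m) (fieldGroup P hcont n) B) {ξ : Field P m}
    (h : Smooth2 hcont ξ) : Smooth2 hcont (B ξ) := fun i =>
  ⟨hB.dom (h i).1, fun k => by rw [hB.D (h i).1]; exact hB.dom ((h i).2 k)⟩

theorem mem_domain_opMatrix {M : Matrix (Fin m) (Fin n) (Fin d → ℂ)} {ξ : Field P n} :
    ξ ∈ (opMatrix P M).domain ↔ Smooth1 hcont ξ := by
  unfold Smooth1
  simp only [field_dom_iff]
  exact forall_comm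

theorem opMatrix_apply {M : Matrix (Fin m) (Fin n) (Fin d → ℂ)} (ξ : (opMatrix P M).domain) :
    opMatrix P M ξ = op hcont M ξ := by
  have h : Smooth1 hcont (ξ : Field P n) := mem_domain_opMatrix.1 ξ.2
  ext1 k
  have h1 : opMatrix P M ξ k = ∑ j, ∑ i, M k j i • gen P i ⟨ξ.1 j, ξ.2 j i⟩ := rfl
  rw [h1, Finset.sum_comm, op, WithLp.ofLp_sum, Finset.sum_apply]
  refine Finset.sum_congr rfl fun i _ => ?_
  rw [cmap_apply]
  refine Finset.sum_congr rfl fun j _ => ?_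
  rw [field_D_apply (h i), gen_apply (hcont := hcont)]
  rfl

theorem op_sub (M : Matrix (Fin m) (Fin n) (Fin d → ℂ)) {ξ ζ : Field P n} (h : Smooth1 hcont ξ)
    (h' : Smooth1 hcont ζ) : op hcont M (ξ - ζ) = op hcont M ξ - op hcont M ζ := by
  simp only [op, D_sub (h _) (h' _), map_sub, Finset.sum_sub_distrib]

theorem dom_sum {ι : Type*} {E : Type*} [NormedAddCommGroup E] [InnerProductSpace ℂ E]
    {U : UnitaryGroup d E} (s : Finset ι) {f : ι → E} {i : Fin d} (h : ∀ j, U.Dom i (f j)) :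
    U.Dom i (∑ j ∈ s, f j) ∧ U.D i (∑ j ∈ s, f j) = ∑ j ∈ s, U.D i (f j) := by
  classical
  induction s using Finset.induction_on with
  | empty => exact ⟨by simpa using dom_zero i, by simp [D, LinearIsometry.map_zero]⟩
  | insert a s ha ih =>
    rw [Finset.sum_insert ha, Finset.sum_insert ha, ← ih.2]
    exact ⟨(h a).add ih.1, D_add (h a) ih.1⟩

theorem Smooth2.op {M : Matrix (Fin m) (Fin n) (Fin d → ℂ)} {ξ : Field P n}
    (h : Smooth2 hcont ξ) : Smooth1 hcont (op hcont M ξ) := fun k =>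
  (dom_sum _ fun i => (cmap_intertwines _).dom ((h i).2 k)).1

theorem lift_op {S : Lp ℂ 2 P →L[ℂ] Lp ℂ 2 P}
    (hS : Intertwines (scalarGroup P hcont) (scalarGroup P hcont) S)
    (M : Matrix (Fin m) (Fin n) (Fin d → ℂ)) {ξ : Field P n} (h : Smooth1 hcont ξ) :
    lift P m S (op hcont M ξ) = op hcont M (lift P n S ξ) := by
  simp only [op, map_sum, (lift_intertwines hS).D (h _), lift_cmap]

/-- The generators are skew and commute with constant matrices, and the coefficients are real, so
the formal adjoint has matrix `-Mᵀ`. -/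
theorem inner_op_left {M : Matrix (Fin m) (Fin n) (Fin d → ℂ)}
    (hM : ∀ i, (slice M i).conjTranspose = (slice M i).transpose) {ξ : Field P n} {ζ : Field P m}
    (h : Smooth1 hcont ξ) (h' : Smooth1 hcont ζ) :
    inner ℂ (op hcont M ξ) ζ = inner ℂ ξ (op hcont (-M.transpose) ζ) := by
  simp only [op, sum_inner, inner_sum]
  refine Finset.sum_congr rfl fun i _ => ?_
  rw [inner_cmap_left, hM, inner_D_left (h i) ((cmap_intertwines _).dom (h' i)),
    (cmap_intertwines _).D (h' i), slice_neg_transpose, cmap_neg, inner_neg_right]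

theorem op_mem_meanZero (M : Matrix (Fin m) (Fin n) (Fin d → ℂ)) {ξ : Field P n}
    (h : Smooth1 hcont ξ) : op hcont M ξ ∈ meanZero P m :=
  Submodule.sum_mem _ fun i _ => meanZero_of_intertwines (cmap_intertwines (hcont := hcont) _)
    (meanZero_D (h i))

theorem op_op (N : Matrix (Fin l) (Fin m) (Fin d → ℂ)) (M : Matrix (Fin m) (Fin n) (Fin d → ℂ))
    {ξ : Field P n} (h : Smooth2 hcont ξ) : op hcont N (op hcont M ξ) =
      ∑ k, ∑ i, cmap P (slice N k * slice M i)
        ((fieldGroup P hcont n).D k ((fieldGroup P hcont n).D i ξ)) := by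
  unfold op
  refine Finset.sum_congr rfl fun k _ => ?_
  rw [(dom_sum _ fun i => (cmap_intertwines _).dom ((h i).2 k)).2, map_sum]
  refine Finset.sum_congr rfl fun i _ => ?_
  rw [(cmap_intertwines _).D ((h i).2 k), cmap_mul]

theorem op_op' (N : Matrix (Fin l) (Fin m) (Fin d → ℂ)) (M : Matrix (Fin m) (Fin n) (Fin d → ℂ))
    {ξ : Field P n} (h : Smooth2 hcont ξ) : op hcont N (op hcont M ξ) =
      ∑ k, ∑ i, cmap P (slice N i * slice M k)
        ((fieldGroup P hcont n).D k ((fieldGroup P hcont n).D i ξ)) := by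
  rw [op_op N M h, Finset.sum_comm]
  refine Finset.sum_congr rfl fun k _ => Finset.sum_congr rfl fun i _ => ?_
  rw [D_comm (h i).1 (h k).1 ((h k).2 i)]

/-- Commuting derivatives allow the composition to be written with the coefficients in either order;
adding the two forms produces the symmetrised coefficients of `HelmholtzPair`. `add_self_cancel`
later removes the doubling. -/
theorem op_op_add (N : Matrix (Fin l) (Fin m) (Fin d → ℂ)) (M : Matrix (Fin m) (Fin n) (Fin d → ℂ))
    {ξ : Field P n} (h : Smooth2 hcont ξ) :
    op hcont N (op hcont M ξ) + op hcont N (op hcont M ξ) =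
      ∑ k, ∑ i, cmap P (slice N k * slice M i + slice N i * slice M k)
        ((fieldGroup P hcont n).D k ((fieldGroup P hcont n).D i ξ)) := by
  conv_lhs => rw [op_op' N M h]
  conv_lhs => enter [1]; rw [← op_op' N M h, op_op N M h]
  simp only [cmap_add, Finset.sum_add_distrib]

theorem add_self_cancel {E : Type*} [AddCommGroup E] [Module ℂ E] {x y : E}
    (h : x + x = y + y) : x = y := by
  rw [← two_smul ℂ, ← two_smul ℂ] at h
  exact smul_right_injective E (two_ne_zero) h

theorem op_op_eq_zero {N : Matrix (Fin l) (Fin m) (Fin d → ℂ)}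
    {M : Matrix (Fin m) (Fin n) (Fin d → ℂ)}
    (hNM : ∀ i k, slice N k * slice M i + slice N i * slice M k = 0)
    {ξ : Field P n} (h : Smooth2 hcont ξ) : op hcont N (op hcont M ξ) = 0 := by
  refine add_self_cancel ?_
  simp [op_op_add N M h, hNM, cmap_zero]

variable {A : Matrix (Fin a) (Fin n) (Fin d → ℂ)} {B : Matrix (Fin b) (Fin n) (Fin d → ℂ)}

theorem HelmholtzPair.op_op_eq_zero (hAB : HelmholtzPair A B) {ξ : Field P a}
    (h : Smooth2 hcont ξ) : op hcont B (op hcont (-A.transpose) ξ) = 0 := by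
  refine Helmholtz.op_op_eq_zero (fun i k => ?_) h
  rw [slice_neg_transpose, slice_neg_transpose, Matrix.mul_neg, Matrix.mul_neg, ← neg_add,
    hAB.comp_eq_zero, neg_zero]

theorem HelmholtzPair.op_op_add_op_op (hAB : HelmholtzPair A B) {ξ : Field P n}
    (h : Smooth2 hcont ξ) :
    op hcont (-A.transpose) (op hcont A ξ) + op hcont (-B.transpose) (op hcont B ξ) =
      -∑ i, (fieldGroup P hcont n).D i ((fieldGroup P hcont n).D i ξ) := by
  refine add_self_cancel ?_
  rw [add_add_add_comm, op_op_add _ _ h, op_op_add _ _ h, ← Finset.sum_add_distrib, ← neg_add,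
    ← Finset.sum_add_distrib, ← Finset.sum_neg_distrib]
  refine Finset.sum_congr rfl fun k _ => ?_
  rw [← Finset.sum_add_distrib]
  have key : ∀ i, slice (-A.transpose) k * slice A i + slice (-A.transpose) i * slice A k +
      (slice (-B.transpose) k * slice B i + slice (-B.transpose) i * slice B k) =
      -(if i = k then 2 else 0) := by
    intro i
    rw [← hAB.laplacian i k]
    simp only [slice_neg_transpose, Matrix.neg_mul]
    abel
  simp only [← cmap_add, key, cmap_neg, Finset.sum_neg_distrib]
  rw [Finset.sum_eq_single k]
  · rw [if_pos rfl, cmap_two]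
  · intro i _ hi
    rw [if_neg hi, cmap_zero]
  · simp

theorem neg_transpose_neg_transpose {R : Type*} [AddCommGroup R]
    (M : Matrix (Fin m) (Fin n) R) : -(-M.transpose).transpose = M := by
  ext i j
  simp

theorem conjTranspose_slice_neg {M : Matrix (Fin m) (Fin n) (Fin d → ℂ)}
    (hM : ∀ i, (slice M i).conjTranspose = (slice M i).transpose) (i : Fin d) :
    (slice (-M.transpose) i).conjTranspose = (slice (-M.transpose) i).transpose := by
  have := congrArg Matrix.transpose (hM i)
  rw [slice_neg_transpose, Matrix.conjTranspose_neg, Matrix.transpose_neg]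
  congr 1

/-- This is `A* A + B* B = -Δ` paired with `ξ` and integrated by parts. It gives uniqueness and, for
potentials in a gauge, control of the whole gradient by a single operator. -/
theorem HelmholtzPair.sum_norm_sq (hAB : HelmholtzPair A B) {ξ : Field P n}
    (h : Smooth2 hcont ξ) :
    ∑ i, ‖(fieldGroup P hcont n).D i ξ‖ ^ 2 = ‖op hcont A ξ‖ ^ 2 + ‖op hcont B ξ‖ ^ 2 := by
  have h1 : ∀ {c : ℕ} {C : Matrix (Fin c) (Fin n) (Fin d → ℂ)},
      (∀ i, (slice C i).conjTranspose = (slice C i).transpose) →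
      (‖op hcont C ξ‖ : ℂ) ^ 2 = inner ℂ ξ (op hcont (-C.transpose) (op hcont C ξ)) := by
    intro c C hC
    rw [← inner_op_left hC h.smooth1 h.op, inner_self_eq_norm_sq_to_K]
    rfl
  have h2 : ∀ i, (‖(fieldGroup P hcont n).D i ξ‖ : ℂ) ^ 2 =
      -inner ℂ ξ ((fieldGroup P hcont n).D i ((fieldGroup P hcont n).D i ξ)) := by
    intro i
    rw [← inner_D_left (h i).1 ((h i).2 i), inner_self_eq_norm_sq_to_K]
    rfl
  have h3 := congrArg (inner ℂ ξ) (hAB.op_op_add_op_op h)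
  rw [inner_add_right, ← h1 hAB.real_left, ← h1 hAB.real_right, inner_neg_right, inner_sum,
    ← Finset.sum_neg_distrib] at h3
  simp only [← h2] at h3
  exact_mod_cast h3.symm

theorem HelmholtzPair.eq_zero (hAB : HelmholtzPair A B) {ξ : Field P n} (h0 : ξ ∈ meanZero P n)
    (h : Smooth2 hcont ξ) (hA : op hcont A ξ = 0) (hB : op hcont B ξ = 0) : ξ = 0 := by
  have := hAB.sum_norm_sq h
  rw [hA, hB, norm_zero, norm_zero, zero_pow two_ne_zero, add_zero,
    Finset.sum_eq_zero_iff_of_nonneg fun _ _ => sq_nonneg _] at this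
  exact eq_zero_of_D_eq_zero h0 h.smooth1 fun i => by simpa using this i (Finset.mem_univ i)

end Operators

/-! ### The Helmholtz decomposition for a pair -/

section Decomposition

variable {Ω : Type*} [MeasurableSpace Ω] {P : Measure Ω} {d : ℕ}
  [AddAction (EuclideanSpace ℝ (Fin d)) Ω] [MeasurableConstVAdd (EuclideanSpace ℝ (Fin d)) Ω]
  [IsProbabilityMeasure P] [ErgodicVAdd (EuclideanSpace ℝ (Fin d)) Ω P]
  {hcont : ∀ f : Lp ℂ 2 P, Continuous fun x : EuclideanSpace ℝ (Fin d) => translate P x f}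
  {a b l m n z : ℕ}

theorem mem_rangeOn {M : Matrix (Fin m) (Fin n) (Fin d → ℂ)} {S : Submodule ℂ (Field P n)}
    {ζ : Field P m} : ζ ∈ rangeOn (opMatrix P M) S ↔
      ∃ φ ∈ S, Smooth1 hcont φ ∧ op hcont M φ = ζ := by
  constructor
  · rintro ⟨φ, rfl⟩
    refine ⟨φ, φ.2.1, mem_domain_opMatrix.1 φ.2.2, ?_⟩
    rw [← opMatrix_apply ⟨(φ : Field P n), φ.2.2⟩]
    rfl
  · rintro ⟨φ, hφ, hs, rfl⟩
    refine ⟨⟨φ, hφ, mem_domain_opMatrix.2 hs⟩, ?_⟩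
    rw [← opMatrix_apply ⟨φ, mem_domain_opMatrix.2 hs⟩]
    rfl

theorem mem_kernel {M : Matrix (Fin m) (Fin n) (Fin d → ℂ)} {ξ : Field P n} :
    ξ ∈ kernel (opMatrix P M) ↔ Smooth1 hcont ξ ∧ op hcont M ξ = 0 := by
  constructor
  · rintro ⟨φ, hφ, rfl⟩
    refine ⟨mem_domain_opMatrix.1 φ.2, ?_⟩
    change op hcont M (φ : Field P n) = 0
    rw [← opMatrix_apply φ]
    exact hφ
  · rintro ⟨hs, h⟩
    refine ⟨⟨ξ, mem_domain_opMatrix.2 hs⟩, ?_, rfl⟩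
    change opMatrix P M ⟨ξ, mem_domain_opMatrix.2 hs⟩ = 0
    rw [opMatrix_apply (hcont := hcont)]
    exact h

variable [NeZero d]

theorem mem_H2 {ξ : Field P n} : ξ ∈ fieldsH2 P d n ↔ ξ ∈ meanZero P n ∧ Smooth2 hcont ξ :=
  mem_fieldsH2_iff

theorem lift_mem_H2 {S : Lp ℂ 2 P →L[ℂ] Lp ℂ 2 P}
    (hS : Intertwines (scalarGroup P hcont) (scalarGroup P hcont) S) {ξ : Field P n}
    (h : ξ ∈ fieldsH2 P d n) : lift P n S ξ ∈ fieldsH2 P d n := by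
  rw [mem_H2 (hcont := hcont)] at h ⊢
  exact ⟨meanZero_of_intertwines (lift_intertwines hS) h.1,
    h.2.of_intertwines (lift_intertwines hS)⟩

theorem smooth2_lift {S : Lp ℂ 2 P →L[ℂ] Lp ℂ 2 P}
    (hS : ∀ f i, (scalarGroup P hcont).Dom i (S f) ∧
      ∀ k, (scalarGroup P hcont).Dom k ((scalarGroup P hcont).D i (S f))) (ξ : Field P n) :
    Smooth2 hcont (lift P n S ξ) := by
  intro i
  have h1 : (fieldGroup P hcont n).Dom i (lift P n S ξ) :=
    field_dom_iff.2 fun j => (hS (ξ j) i).1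
  refine ⟨h1, fun k => field_dom_iff.2 fun j => ?_⟩
  rw [field_D_apply h1]
  exact (hS (ξ j) i).2 k

variable (hcont) in
/-- Smoothing operators on fields. -/
theorem exists_field_smoothing : ∃ S : ℕ → Lp ℂ 2 P →L[ℂ] Lp ℂ 2 P,
    (∀ k, Intertwines (scalarGroup P hcont) (scalarGroup P hcont) (S k)) ∧
    (∀ (n : ℕ) (ξ : Field P n), Tendsto (fun k => lift P n (S k) ξ) atTop (𝓝 ξ)) ∧
    (∀ (n k : ℕ) (ξ : Field P n), Smooth2 hcont (lift P n (S k) ξ)) := by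
  obtain ⟨S, h1, h2, h3⟩ := (scalarGroup P hcont).exists_smoothing
  exact ⟨S, h1, fun n ξ => tendsto_lift h2 ξ, fun n k ξ => smooth2_lift (h3 k) ξ⟩

include hcont in
-- Smoothing preserves mean zero and converges to the identity, so the regular fields are dense
-- among all mean-zero fields.
theorem hilbert_eq_meanZero (n : ℕ) :
    (fieldsH2 P d n).topologicalClosure = meanZero P n := by
  refine le_antisymm (Submodule.topologicalClosure_minimal _
    (fun ξ h => ((mem_H2 (hcont := hcont)).1 h).1) (isClosed_meanZero n)) fun ξ hξ => ?_
  obtain ⟨S, h1, h2, h3⟩ := exists_field_smoothing hcont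
  exact mem_closure_of_tendsto (h2 n ξ) (Eventually.of_forall fun k =>
    (mem_H2 (hcont := hcont)).2 ⟨meanZero_of_intertwines (lift_intertwines (h1 k)) hξ, h3 n k ξ⟩)

theorem eq_zero_of_inner_H2 {ξ : Field P n} (hξ : ξ ∈ meanZero P n)
    (h : ∀ φ ∈ fieldsH2 P d n, inner ℂ φ ξ = 0) (hcont : ∀ f : Lp ℂ 2 P,
      Continuous fun x : EuclideanSpace ℝ (Fin d) => translate P x f) : ξ = 0 := by
  rw [← hilbert_eq_meanZero (hcont := hcont)] at hξ
  have h1 : ξ ∈ (fieldsH2 P d n)ᗮ := (Submodule.mem_orthogonal _ _).2 h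
  rw [← Submodule.orthogonal_closure] at h1
  exact inner_self_eq_zero.1 ((Submodule.mem_orthogonal _ _).1 h1 ξ hξ)

variable (P) in
/-- The closure of the range of the first order operator with matrix `M` on `𝓗²` fields. -/
def rangeClosure (M : Matrix (Fin m) (Fin n) (Fin d → ℂ)) : Submodule ℂ (Field P m) :=
  (rangeOn (opMatrix P M) (fieldsH2 P d n)).topologicalClosure

instance (M : Matrix (Fin m) (Fin n) (Fin d → ℂ)) : CompleteSpace (rangeClosure P M) :=
  (Submodule.isClosed_topologicalClosure _).completeSpace_coe

theorem op_mem_rangeClosure_of_H2 (M : Matrix (Fin m) (Fin n) (Fin d → ℂ)) {φ : Field P n}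
    (h : φ ∈ fieldsH2 P d n) : op hcont M φ ∈ rangeClosure P M :=
  Submodule.le_topologicalClosure _
    (mem_rangeOn.2 ⟨φ, h, ((mem_H2 (hcont := hcont)).1 h).2.smooth1, rfl⟩)

theorem rangeClosure_le {M : Matrix (Fin m) (Fin n) (Fin d → ℂ)} {K : Submodule ℂ (Field P m)}
    (hK : IsClosed (K : Set (Field P m)))
    (h : ∀ φ ∈ fieldsH2 P d n, op hcont M φ ∈ K) : rangeClosure P M ≤ K := by
  refine Submodule.topologicalClosure_minimal _ (fun ζ hζ => ?_) hK
  obtain ⟨φ, hφ, _, rfl⟩ := (mem_rangeOn (hcont := hcont)).1 hζ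
  exact h φ hφ

include hcont in
theorem rangeClosure_le_meanZero (M : Matrix (Fin m) (Fin n) (Fin d → ℂ)) :
    rangeClosure P M ≤ meanZero P m :=
  rangeClosure_le (hcont := hcont) (isClosed_meanZero m) fun _ h =>
    op_mem_meanZero M ((mem_H2 (hcont := hcont)).1 h).2.smooth1

theorem mem_orthogonal_rangeClosure {M : Matrix (Fin m) (Fin n) (Fin d → ℂ)} {ξ : Field P m} :
    ξ ∈ (rangeClosure P M)ᗮ ↔ ∀ φ ∈ fieldsH2 P d n, inner ℂ (op hcont M φ) ξ = 0 := by
  rw [rangeClosure, Submodule.orthogonal_closure, Submodule.mem_orthogonal]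
  constructor
  · exact fun h φ hφ => h _
      (mem_rangeOn.2 ⟨φ, hφ, ((mem_H2 (hcont := hcont)).1 hφ).2.smooth1, rfl⟩)
  · intro h ζ hζ
    obtain ⟨φ, hφ, _, rfl⟩ := (mem_rangeOn (hcont := hcont)).1 hζ
    exact h φ hφ

/-- One derivative suffices: smoothing commutes with the operator, so smoothing the image amounts to
applying the operator to a potential in `𝓗²`. -/
theorem op_mem_rangeClosure (M : Matrix (Fin m) (Fin n) (Fin d → ℂ)) {φ : Field P n}
    (h0 : φ ∈ meanZero P n) (h : Smooth1 hcont φ) : op hcont M φ ∈ rangeClosure P M := by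
  obtain ⟨S, h1, h2, h3⟩ := exists_field_smoothing hcont
  have hc : IsClosed (rangeClosure P M : Set (Field P m)) :=
    Submodule.isClosed_topologicalClosure _
  refine hc.mem_of_tendsto (h2 m _) (Eventually.of_forall fun k => ?_)
  rw [lift_op (h1 k) M h]
  exact op_mem_rangeClosure_of_H2 M ((mem_H2 (hcont := hcont)).2
    ⟨meanZero_of_intertwines (lift_intertwines (h1 k)) h0, h3 n k φ⟩)

/-- Constants are killed by the operator, so the mean can be subtracted first. This covers the test
fields of the weak equations, which need not have mean zero. -/
theorem op_mem_rangeClosure' (M : Matrix (Fin m) (Fin n) (Fin d → ℂ)) {φ : Field P n}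
    (h : Smooth1 hcont φ) : op hcont M φ ∈ rangeClosure P M := by
  have hc : Smooth1 hcont (constField P (mean P φ)) := fun i =>
    dom_of_hasDerivAt (hasDerivAt_constField _ i)
  have hz : op hcont M (constField P (mean P φ)) = 0 := by
    simp only [op, D_of_hasDerivAt (hasDerivAt_constField (hcont := hcont) (mean P φ) _), _root_.map_zero,
      Finset.sum_const_zero]
  have := op_mem_rangeClosure M (sub_constField_mem φ) (h.sub hc)
  rwa [op_sub M h hc, hz, sub_zero] at this

variable {A : Matrix (Fin a) (Fin n) (Fin d → ℂ)} {B : Matrix (Fin b) (Fin n) (Fin d → ℂ)}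

theorem inner_op_neg_transpose (hA : ∀ i, (slice A i).conjTranspose = (slice A i).transpose)
    {φ : Field P a} {ξ : Field P n} (h : Smooth1 hcont φ) (h' : Smooth1 hcont ξ) :
    inner ℂ (op hcont (-A.transpose) φ) ξ = inner ℂ φ (op hcont A ξ) := by
  rw [inner_op_left (conjTranspose_slice_neg hA) h h', neg_transpose_neg_transpose]

/-- By parts, orthogonality to the range of the adjoint says that `A ξ` is orthogonal to all of
`𝓗²`. As `A ξ` has mean zero and `𝓗²` is dense there, `A ξ` vanishes. -/
theorem op_eq_zero_iff (hA : ∀ i, (slice A i).conjTranspose = (slice A i).transpose)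
    {ξ : Field P n} (h : Smooth1 hcont ξ) :
    op hcont A ξ = 0 ↔ ξ ∈ (rangeClosure P (-A.transpose))ᗮ := by
  rw [mem_orthogonal_rangeClosure (hcont := hcont)]
  constructor
  · intro h0 φ hφ
    rw [inner_op_neg_transpose hA ((mem_H2 (hcont := hcont)).1 hφ).2.smooth1 h, h0,
      inner_zero_right]
  · intro h0
    refine eq_zero_of_inner_H2 (op_mem_meanZero A h) (fun φ hφ => ?_) hcont
    rw [← inner_op_neg_transpose hA ((mem_H2 (hcont := hcont)).1 hφ).2.smooth1 h]
    exact h0 φ hφ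

namespace HelmholtzPair

variable (hAB : HelmholtzPair A B)
include hAB

include hcont in
-- By `op_eq_zero_iff`, orthogonality to the range of `B*` is the identity `B A* φ = 0`.
theorem orthogonal : rangeClosure P (-A.transpose) ⟂ rangeClosure P (-B.transpose) := by
  refine rangeClosure_le (hcont := hcont) (Submodule.isClosed_orthogonal _) fun φ hφ => ?_
  have hφ' := ((mem_H2 (hcont := hcont)).1 hφ).2
  exact (op_eq_zero_iff hAB.real_right hφ'.op).1 (hAB.op_op_eq_zero hφ')

include hcont in
-- This is the completeness half of the decomposition. Both orthogonality conditions survive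
-- smoothing, whose adjoint preserves the ranges; the smoothed field is then killed by `A` and `B`,
-- so it is zero, and so is its limit.
theorem eq_zero_of_mem_orthogonal {ξ : Field P n} (h0 : ξ ∈ meanZero P n)
    (hA : ξ ∈ (rangeClosure P (-A.transpose))ᗮ) (hB : ξ ∈ (rangeClosure P (-B.transpose))ᗮ) :
    ξ = 0 := by
  obtain ⟨S, h1, h2, h3⟩ := exists_field_smoothing hcont
  have key : ∀ {c : ℕ} {C : Matrix (Fin c) (Fin n) (Fin d → ℂ)} (k : ℕ),
      ξ ∈ (rangeClosure P (-C.transpose))ᗮ →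
      lift P n (S k) ξ ∈ (rangeClosure P (-C.transpose))ᗮ := by
    intro c C k hξ
    rw [mem_orthogonal_rangeClosure (hcont := hcont)] at hξ ⊢
    intro φ hφ
    rw [← inner_conj_symm, inner_lift_left, inner_conj_symm,
      lift_op (h1 k).adjoint _ ((mem_H2 (hcont := hcont)).1 hφ).2.smooth1]
    exact hξ _ (lift_mem_H2 (h1 k).adjoint hφ)
  have hz : ∀ k, lift P n (S k) ξ = 0 := fun k =>
    hAB.eq_zero (meanZero_of_intertwines (lift_intertwines (h1 k)) h0) (h3 n k ξ)
      ((op_eq_zero_iff hAB.real_left (h3 n k ξ).smooth1).2 (key k hA))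
      ((op_eq_zero_iff hAB.real_right (h3 n k ξ).smooth1).2 (key k hB))
  refine tendsto_nhds_unique (h2 n ξ) ?_
  simp only [hz]
  exact tendsto_const_nhds

include hcont in
-- The remainder after subtracting both projections has mean zero and, the ranges being orthogonal,
-- is orthogonal to both.
theorem add_starProjection {ξ : Field P n} (h0 : ξ ∈ meanZero P n) :
    (rangeClosure P (-A.transpose)).starProjection ξ +
      (rangeClosure P (-B.transpose)).starProjection ξ = ξ := by
  set G := rangeClosure P (-A.transpose)
  set K := rangeClosure P (-B.transpose)
  have hGK : G ⟂ K := hAB.orthogonal (hcont := hcont)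
  have hG : G.starProjection ξ ∈ G := Submodule.starProjection_apply_mem _ _
  have hK : K.starProjection ξ ∈ K := Submodule.starProjection_apply_mem _ _
  symm
  rw [← sub_eq_zero]
  refine hAB.eq_zero_of_mem_orthogonal (hcont := hcont) ?_ ?_ ?_
  · exact Submodule.sub_mem _ h0 (Submodule.add_mem _
      (rangeClosure_le_meanZero (hcont := hcont) _ hG)
      (rangeClosure_le_meanZero (hcont := hcont) _ hK))
  · rw [← sub_sub]
    exact Submodule.sub_mem _ (G.sub_starProjection_mem_orthogonal ξ) (hGK.symm hK)
  · rw [add_comm, ← sub_sub]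
    exact Submodule.sub_mem _ (K.sub_starProjection_mem_orthogonal ξ) (hGK hG)

include hcont in
theorem sup_eq : rangeClosure P (-A.transpose) ⊔ rangeClosure P (-B.transpose) = meanZero P n := by
  refine le_antisymm (sup_le (rangeClosure_le_meanZero (hcont := hcont) _)
    (rangeClosure_le_meanZero (hcont := hcont) _)) fun ξ hξ => ?_
  rw [← hAB.add_starProjection (hcont := hcont) hξ]
  exact Submodule.add_mem_sup (Submodule.starProjection_apply_mem _ _)
    (Submodule.starProjection_apply_mem _ _)

include hcont in
theorem mem_rangeClosure {ξ : Field P n} (h0 : ξ ∈ meanZero P n)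
    (h : ξ ∈ (rangeClosure P (-A.transpose))ᗮ) : ξ ∈ rangeClosure P (-B.transpose) := by
  rw [← hAB.add_starProjection (hcont := hcont) h0,
    (Submodule.starProjection_apply_eq_zero_iff _).2 h, zero_add]
  exact Submodule.starProjection_apply_mem _ _

include hcont in
/-- The closure of the smooth kernel of one operator of a pair is the closed range of the adjoint
of the other. -/
theorem closure_kernel : (fieldsH2 P d n ⊓ kernel (opMatrix P A)).topologicalClosure =
    rangeClosure P (-B.transpose) := by
  refine le_antisymm (Submodule.topologicalClosure_minimal _ (fun ξ hξ => ?_)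
    (Submodule.isClosed_topologicalClosure _)) (rangeClosure_le (hcont := hcont)
      (Submodule.isClosed_topologicalClosure _) fun ψ hψ => ?_)
  · have hk := (mem_kernel (hcont := hcont)).1 hξ.2
    exact hAB.mem_rangeClosure (hcont := hcont) ((mem_H2 (hcont := hcont)).1 hξ.1).1
      ((op_eq_zero_iff hAB.real_left hk.1).1 hk.2)
  -- `B* ψ` is only known to be once differentiable, so it is approximated by its smoothings. These
  -- are `B*` of smoothed potentials, hence still in the kernel of `A`.
  · obtain ⟨S, h1, h2, h3⟩ := exists_field_smoothing hcont
    have hψ' := (mem_H2 (hcont := hcont)).1 hψ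
    refine mem_closure_of_tendsto (h2 n _) (Eventually.of_forall fun k => ?_)
    refine ⟨(mem_H2 (hcont := hcont)).2 ⟨meanZero_of_intertwines (lift_intertwines (h1 k))
      (op_mem_meanZero _ hψ'.2.smooth1), h3 n k _⟩, (mem_kernel (hcont := hcont)).2
      ⟨(h3 n k _).smooth1, ?_⟩⟩
    rw [lift_op (h1 k) _ hψ'.2.smooth1]
    exact hAB.symm.op_op_eq_zero (hψ'.2.of_intertwines (lift_intertwines (h1 k)))

include hcont in
/-- Every potential can be replaced by one in the gauge `A = 0`. -/
theorem exists_gauge {ξ : Field P n} (h : ξ ∈ fieldsH2 P d n) :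
    ∃ κ ∈ fieldsH2 P d n, op hcont A κ = 0 ∧ op hcont B κ = op hcont B ξ := by
  set G := rangeClosure P (-A.transpose)
  set K := rangeClosure P (-B.transpose)
  have h' := (mem_H2 (hcont := hcont)).1 h
  have hGK : G ⟂ K := hAB.orthogonal (hcont := hcont)
  -- Translation invariance of `K` makes its projection commute with the group, so the projected
  -- potential keeps two derivatives.
  have hinv : ∀ x, ∀ f ∈ K, (fieldGroup P hcont n).map x f ∈ K := by
    intro x f hf
    refine rangeClosure_le (hcont := hcont) (K := K.comap ((fieldGroup P hcont n).map x).toLinearMap)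
      ?_ (fun φ hφ => ?_) hf
    · exact (Submodule.isClosed_topologicalClosure _).preimage
        ((fieldGroup P hcont n).map x).continuous
    · have hx : Intertwines (scalarGroup P hcont) (scalarGroup P hcont)
        ((scalarGroup P hcont).map x).toContinuousLinearMap := map_intertwines x
      have := lift_op hx (-B.transpose) ((mem_H2 (hcont := hcont)).1 hφ).2.smooth1
      change lift P n ((scalarGroup P hcont).map x).toContinuousLinearMap _ ∈ K
      rw [this]
      exact op_mem_rangeClosure_of_H2 _ (lift_mem_H2 hx hφ)
  have hK : K.starProjection ξ ∈ K := Submodule.starProjection_apply_mem _ _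
  have hs : Smooth2 hcont (K.starProjection ξ) :=
    h'.2.of_intertwines (starProjection_intertwines hinv)
  -- The projection is orthogonal to `G`, so `A` kills it; the part removed is orthogonal to `K`, so
  -- `B` kills that.
  refine ⟨K.starProjection ξ, (mem_H2 (hcont := hcont)).2
    ⟨rangeClosure_le_meanZero (hcont := hcont) _ hK, hs⟩,
    (op_eq_zero_iff hAB.real_left hs.smooth1).2 (hGK.symm hK), ?_⟩
  rw [eq_comm, ← sub_eq_zero, ← op_sub B h'.2.smooth1 hs.smooth1,
    op_eq_zero_iff hAB.real_right (h'.2.smooth1.sub hs.smooth1)]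
  exact K.sub_starProjection_mem_orthogonal ξ

end HelmholtzPair

end Decomposition

/-! ### Graphs and closures of partially defined operators -/

section PartialMaps

variable {E F G : Type*} [AddCommGroup E] [Module ℂ E] [AddCommGroup F] [Module ℂ F]
    [AddCommGroup G] [Module ℂ G]

theorem mem_graph_pcomp {g : F →ₗ.[ℂ] G} {f : E →ₗ.[ℂ] F} {x : E} {w : G} :
    (x, w) ∈ (pcomp g f).graph ↔ ∃ y, (x, y) ∈ f.graph ∧ (y, w) ∈ g.graph := by
  simp only [LinearPMap.mem_graph_iff]
  constructor
  · rintro ⟨⟨x', hx, hx'⟩, rfl, rfl⟩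
    exact ⟨_, ⟨⟨x', hx⟩, rfl, rfl⟩, ⟨_, hx'⟩, rfl, rfl⟩
  · rintro ⟨y, ⟨x', rfl, rfl⟩, y', hy, rfl⟩
    have hd : f x' ∈ g.domain := hy ▸ y'.2
    refine ⟨⟨x', x'.2, hd⟩, rfl, ?_⟩
    change g ⟨f x', hd⟩ = g y'
    congr 1
    exact Subtype.ext hy.symm

theorem mem_graph_domRestrict {f : E →ₗ.[ℂ] F} {S : Submodule ℂ E} {x : E} {y : F} :
    (x, y) ∈ (f.domRestrict S).graph ↔ x ∈ S ∧ (x, y) ∈ f.graph := by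
  simp only [LinearPMap.mem_graph_iff]
  constructor
  · rintro ⟨x', rfl, rfl⟩
    exact ⟨x'.2.1, ⟨x', x'.2.2⟩, rfl, rfl⟩
  · rintro ⟨hS, x', rfl, rfl⟩
    exact ⟨⟨x', hS, x'.2⟩, rfl, rfl⟩

theorem ker_eq_bot_iff_graph {f : E →ₗ.[ℂ] F} :
    LinearMap.ker f.toFun = ⊥ ↔ ∀ x, (x, 0) ∈ f.graph → x = 0 := by
  rw [LinearMap.ker_eq_bot']
  simp only [LinearPMap.mem_graph_iff]
  constructor
  · rintro h x ⟨y, rfl, hy⟩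
    exact congrArg Subtype.val (h y hy)
  · exact fun h y hy => Subtype.ext (h y ⟨y, rfl, hy⟩)

/-- With the inverse read as a swapped graph, the condition is that `y` is a `T`-image and `T'`
takes the same value at `x` and `y`: the description of a projection along the kernel of `T'`. -/
theorem mem_graph_projOp {T : E →ₗ.[ℂ] F} {T' : F →ₗ.[ℂ] E} {S : Submodule ℂ E}
    (hker : LinearMap.ker ((pcomp T' T).domRestrict S).toFun = ⊥) {x y : F} :
    (x, y) ∈ (projOp T T' S).graph ↔ ∃ φ ∈ S, (φ, y) ∈ T.graph ∧
      ∃ η, (x, η) ∈ T'.graph ∧ (y, η) ∈ T'.graph := by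
  simp only [projOp, mem_graph_pcomp, LinearPMap.inverse_graph hker, Submodule.mem_map,
    Prod.exists, mem_graph_domRestrict]
  constructor
  · rintro ⟨φ, ⟨η, hη, φ', η', ⟨hS, y', hy', hy''⟩, h⟩, hφ⟩
    obtain ⟨rfl, rfl⟩ := Prod.ext_iff.1 h
    obtain rfl : y' = y := T.mem_graph_snd_inj hy' hφ rfl
    exact ⟨φ', hS, hφ, η', hη, hy''⟩
  · rintro ⟨φ, hS, hφ, η, hx, hy⟩
    exact ⟨φ, ⟨η, hx, φ, η, ⟨hS, y, hφ, hy⟩, rfl⟩, hφ⟩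

end PartialMaps

/-- A densely defined restriction of a bounded operator has that operator as its closure. -/
theorem closure_eq_toPMap {F : Type*} [NormedAddCommGroup F] [InnerProductSpace ℂ F]
    {A : F →ₗ.[ℂ] F} {Q : F →L[ℂ] F} (hA : ∀ x y, (x, y) ∈ A.graph → y = Q x)
    (hd : Dense (A.domain : Set F)) : A.closure = (Q : F →ₗ[ℂ] F).toPMap ⊤ := by
  have hQ : ∀ x y, (x, y) ∈ ((Q : F →ₗ[ℂ] F).toPMap ⊤).graph ↔ y = Q x := by
    intro x y
    rw [LinearPMap.mem_graph_iff]
    constructor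
    · rintro ⟨x', rfl, rfl⟩
      rfl
    · rintro rfl
      exact ⟨⟨x, trivial⟩, rfl, rfl⟩
  have key : A.graph.topologicalClosure = ((Q : F →ₗ[ℂ] F).toPMap ⊤).graph := by
    refine le_antisymm (Submodule.topologicalClosure_minimal _
      (fun p hp => (hQ p.1 p.2).2 (hA p.1 p.2 hp)) ?_) ?_
    · have : (((Q : F →ₗ[ℂ] F).toPMap ⊤).graph : Set (F × F)) = {p | p.2 = Q p.1} := by
        ext p
        exact hQ p.1 p.2
      rw [this]
      exact isClosed_eq continuous_snd (Q.continuous.comp continuous_fst)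
    -- Along a sequence in the domain tending to `x`, the values of `A` are those of `Q` and
    -- converge to `Q x`.
    · rintro ⟨x, y⟩ hp
      obtain rfl := (hQ x y).1 hp
      obtain ⟨u, hu, hux⟩ := mem_closure_iff_seq_limit.1 (hd x)
      refine mem_closure_of_tendsto (hux.prodMk_nhds ((Q.continuous.tendsto x).comp hux))
        (Eventually.of_forall fun k => ?_)
      have hm : (u k, A ⟨u k, hu k⟩) ∈ A.graph := LinearPMap.mem_graph A ⟨u k, hu k⟩
      rwa [hA _ _ hm] at hm
  have hc : A.IsClosable := ⟨_, key⟩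
  exact LinearPMap.eq_of_eq_graph (hc.graph_closure_eq_closure_graph.symm.trans key)

/-! ### The operators `Γ` and `Υ` as projections -/

section Operators

variable {Ω : Type*} [MeasurableSpace Ω] {P : Measure Ω} {d : ℕ}
  [AddAction (EuclideanSpace ℝ (Fin d)) Ω] [MeasurableConstVAdd (EuclideanSpace ℝ (Fin d)) Ω]
  [IsProbabilityMeasure P] [ErgodicVAdd (EuclideanSpace ℝ (Fin d)) Ω P]
  {hcont : ∀ f : Lp ℂ 2 P, Continuous fun x : EuclideanSpace ℝ (Fin d) => translate P x f}
  {a b l m n z : ℕ}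

theorem mem_graph_opMatrix {M : Matrix (Fin m) (Fin n) (Fin d → ℂ)} {ξ : Field P n}
    {ζ : Field P m} : (ξ, ζ) ∈ (opMatrix P M).graph ↔ Smooth1 hcont ξ ∧ op hcont M ξ = ζ := by
  rw [LinearPMap.mem_graph_iff]
  constructor
  · rintro ⟨ξ', rfl, rfl⟩
    exact ⟨mem_domain_opMatrix.1 ξ'.2, (opMatrix_apply ξ').symm⟩
  · rintro ⟨hs, rfl⟩
    exact ⟨⟨ξ, mem_domain_opMatrix.2 hs⟩, rfl, opMatrix_apply _⟩

variable [NeZero d]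

section Projection

-- For `Γ`: `A` is the curl, `B = ∇*`, `T = ∇` and `Z = 0`. For `Υ`: `A = ∇*`, `B` is the curl, `T`
-- its adjoint and `Z` the gauge condition.
variable {A : Matrix (Fin a) (Fin n) (Fin d → ℂ)} {B : Matrix (Fin b) (Fin n) (Fin d → ℂ)}
  {T : Matrix (Fin n) (Fin b) (Fin d → ℂ)} {Z : Matrix (Fin z) (Fin b) (Fin d → ℂ)}
  (hAB : HelmholtzPair A B) (hZT : HelmholtzPair Z T) (hT : -B.transpose = T)
include hAB hZT hT

include hcont in
-- As `T` is the adjoint of `B`, `B T φ = 0` forces `‖T φ‖² = 0`; with `Z φ = 0`, the pair `(Z, T)`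
-- leaves only `φ = 0`.
theorem ker_pcomp_eq_bot : LinearMap.ker ((pcomp (opMatrix P B) (opMatrix P T)).domRestrict
    (fieldsH2 P d b ⊓ kernel (opMatrix P Z))).toFun = ⊥ := by
  subst hT
  rw [ker_eq_bot_iff_graph]
  intro φ hφ
  rw [mem_graph_domRestrict, mem_graph_pcomp] at hφ
  obtain ⟨⟨hH, hZ⟩, ξ, hφξ, hξ⟩ := hφ
  rw [mem_graph_opMatrix (hcont := hcont)] at hφξ hξ
  obtain ⟨hφ, rfl⟩ := hφξ
  have hH' := (mem_H2 (hcont := hcont)).1 hH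
  refine hZT.eq_zero hH'.1 hH'.2 ((mem_kernel (hcont := hcont)).1 hZ).2 ?_
  rw [← inner_self_eq_zero (𝕜 := ℂ), inner_op_neg_transpose hAB.real_right hφ hξ.1, hξ.2,
    inner_zero_right]

include hcont in
theorem mem_graph_projOp_of_kernel {ξ : Field P n} (h : Smooth1 hcont ξ) (hB : op hcont B ξ = 0) :
    (ξ, 0) ∈ (projOp (opMatrix P T) (opMatrix P B)
      (fieldsH2 P d b ⊓ kernel (opMatrix P Z))).graph := by
  rw [mem_graph_projOp (ker_pcomp_eq_bot (hcont := hcont) hAB hZT hT)]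
  exact ⟨0, Submodule.zero_mem _, Submodule.zero_mem _, 0,
    (mem_graph_opMatrix (hcont := hcont)).2 ⟨h, hB⟩, Submodule.zero_mem _⟩

include hcont in
theorem constField_mem_graph_projOp (c : Fin n → ℂ) :
    (constField P c, 0) ∈ (projOp (opMatrix P T) (opMatrix P B)
      (fieldsH2 P d b ⊓ kernel (opMatrix P Z))).graph := by
  refine mem_graph_projOp_of_kernel (hcont := hcont) hAB hZT hT
    (fun i => dom_of_hasDerivAt (hasDerivAt_constField _ i)) ?_
  simp only [op, D_of_hasDerivAt (hasDerivAt_constField (hcont := hcont) c _), _root_.map_zero,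
    Finset.sum_const_zero]

include hcont in
-- The domain contains the constants, the regular kernel of `B` and the images `T φ`. The last two
-- are dense in the two summands of the mean-zero fields.
theorem dense_domain_projOp : Dense ((projOp (opMatrix P T) (opMatrix P B)
    (fieldsH2 P d b ⊓ kernel (opMatrix P Z))).domain : Set (Field P n)) := by
  set Γ := projOp (opMatrix P T) (opMatrix P B) (fieldsH2 P d b ⊓ kernel (opMatrix P Z)) with hΓ
  have hcl : IsClosed (Γ.domain.topologicalClosure : Set (Field P n)) :=
    Submodule.isClosed_topologicalClosure _
  rw [Submodule.dense_iff_topologicalClosure_eq_top, eq_top_iff]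
  intro ξ _
  have hc : constField P (mean P ξ) ∈ Γ.domain :=
    LinearPMap.mem_domain_of_mem_graph (constField_mem_graph_projOp (hcont := hcont) hAB hZT hT _)
  have hA : rangeClosure P (-A.transpose) ≤ Γ.domain.topologicalClosure := by
    rw [← hAB.symm.closure_kernel (hcont := hcont)]
    refine Submodule.topologicalClosure_minimal _ (fun ζ hζ => ?_) hcl
    have hk := (mem_kernel (hcont := hcont)).1 hζ.2
    exact Submodule.le_topologicalClosure _ (LinearPMap.mem_domain_of_mem_graph
      (mem_graph_projOp_of_kernel (hcont := hcont) hAB hZT hT hk.1 hk.2))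
  have hB : rangeClosure P (-B.transpose) ≤ Γ.domain.topologicalClosure := by
    rw [hT]
    refine rangeClosure_le (hcont := hcont) hcl fun φ hφ => Submodule.le_topologicalClosure _ ?_
    -- The potential `φ` may violate the gauge `Z = 0` required by the inverse; `κ` satisfies it and
    -- has the same image.
    obtain ⟨κ, hκ, hκZ, hκT⟩ := hZT.exists_gauge (hcont := hcont) hφ
    have hs := ((mem_H2 (hcont := hcont)).1 hκ).2
    rw [← hκT]
    refine LinearPMap.mem_domain_of_mem_graph (y := op hcont T κ) ?_
    rw [hΓ, mem_graph_projOp (ker_pcomp_eq_bot (hcont := hcont) hAB hZT hT)]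
    exact ⟨κ, ⟨hκ, (mem_kernel (hcont := hcont)).2 ⟨hs.smooth1, hκZ⟩⟩,
      (mem_graph_opMatrix (hcont := hcont)).2 ⟨hs.smooth1, rfl⟩, op hcont B (op hcont T κ),
      (mem_graph_opMatrix (hcont := hcont)).2 ⟨hs.op, rfl⟩,
      (mem_graph_opMatrix (hcont := hcont)).2 ⟨hs.op, rfl⟩⟩
  have h1 := (sup_le hA hB) ((hAB.sup_eq (hcont := hcont)).symm ▸ sub_constField_mem ξ)
  have h2 := Submodule.add_mem _ h1 (Submodule.le_topologicalClosure _ hc)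
  rwa [sub_add_cancel] at h2

include hcont in
-- On the graph, `ζ` lies in the range of `T` and `B (ξ - ζ) = 0`, so `ξ - ζ` is orthogonal to that
-- range and `ζ` is the projection of `ξ`.
theorem closure_projOp : (projOp (opMatrix P T) (opMatrix P B)
    (fieldsH2 P d b ⊓ kernel (opMatrix P Z))).closure =
      ((rangeClosure P T).starProjection : Field P n →ₗ[ℂ] Field P n).toPMap ⊤ := by
  refine closure_eq_toPMap (fun ξ ζ h => ?_) (dense_domain_projOp (hcont := hcont) hAB hZT hT)
  rw [mem_graph_projOp (ker_pcomp_eq_bot (hcont := hcont) hAB hZT hT)] at h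
  obtain ⟨φ, ⟨hφ, _⟩, hφζ, η, hξ, hζ⟩ := h
  rw [mem_graph_opMatrix (hcont := hcont)] at hφζ hξ hζ
  obtain ⟨_, rfl⟩ := hφζ
  refine (Submodule.eq_starProjection_of_mem_orthogonal (op_mem_rangeClosure_of_H2 T hφ) ?_).symm
  subst hT
  rw [← op_eq_zero_iff hAB.real_right (hξ.1.sub hζ.1), op_sub B hξ.1 hζ.1, hξ.2, hζ.2, sub_self]

end Projection

/-! ### Closed ranges under a Poincaré inequality -/

section Poincare

theorem cauchySeq_of_dist_le {E F : Type*} [PseudoMetricSpace E] [PseudoMetricSpace F]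
    {u : ℕ → E} {v : ℕ → F} {C : ℝ} (hv : CauchySeq v)
    (h : ∀ j k, dist (u j) (u k) ≤ C * dist (v j) (v k)) : CauchySeq u := by
  rw [cauchySeq_iff_tendsto_dist_atTop_0] at hv ⊢
  exact squeeze_zero (fun _ => dist_nonneg) (fun p => h p.1 p.2) (by simpa using hv.const_mul C)

variable {T : Matrix (Fin n) (Fin b) (Fin d → ℂ)} {Z : Matrix (Fin z) (Fin b) (Fin d → ℂ)}

/-- Under a Poincaré inequality the range of an operator with a gauge is closed. -/
theorem rangeClosure_eq_rangeOn (hZT : HelmholtzPair Z T) {β : ℝ} (hβ : 0 < β)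
    (h : ∀ φ : Field P b, φ ∈ meanZero P b → Smooth2 hcont φ →
      β * ‖φ‖ ^ 2 ≤ ∑ i, ‖(fieldGroup P hcont b).D i φ‖ ^ 2) :
    rangeClosure P T = rangeOn (opMatrix P T) (fieldsH1 P d b) := by
  refine le_antisymm (fun ζ hζ => ?_) fun ζ hζ => ?_
  · obtain ⟨u, hu, hlim⟩ := mem_closure_iff_seq_limit.1 hζ
    have hex : ∀ k, ∃ κ ∈ fieldsH2 P d b, op hcont Z κ = 0 ∧ op hcont T κ = u k := by
      intro k
      obtain ⟨φ, hφ, _, hφu⟩ := (mem_rangeOn (hcont := hcont)).1 (hu k)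
      obtain ⟨κ, hκ, hκZ, hκT⟩ := hZT.exists_gauge (hcont := hcont) hφ
      exact ⟨κ, hκ, hκZ, hκT.trans hφu⟩
    choose κ hκ hκZ hκT using hex
    have hs : ∀ k, Smooth2 hcont (κ k) := fun k => ((mem_H2 (hcont := hcont)).1 (hκ k)).2
    -- In the gauge the `Z` term of the energy identity drops out, so gradients of differences of
    -- potentials are measured by the images `u` alone.
    have hsum : ∀ j k, ∑ i, ‖(fieldGroup P hcont b).D i (κ j - κ k)‖ ^ 2 = dist (u j) (u k) ^ 2 := by
      intro j k
      have hd := (mem_H2 (hcont := hcont)).1 (Submodule.sub_mem _ (hκ j) (hκ k))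
      rw [hZT.sum_norm_sq hd.2, op_sub Z (hs j).smooth1 (hs k).smooth1,
        op_sub T (hs j).smooth1 (hs k).smooth1, hκZ, hκZ, hκT, hκT, dist_eq_norm]
      simp
    have hu' := hlim.cauchySeq
    have hκc : CauchySeq κ := by
      -- Poincaré and `hsum` give `β ‖κ j - κ k‖² ≤ ‖u j - u k‖²`, hence the constant.
      refine cauchySeq_of_dist_le (C := (Real.sqrt β)⁻¹) hu' fun j k => ?_
      have hd := (mem_H2 (hcont := hcont)).1 (Submodule.sub_mem _ (hκ j) (hκ k))
      have h1 := h _ hd.1 hd.2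
      rw [hsum, ← dist_eq_norm] at h1
      have hβ' := Real.sqrt_pos.2 hβ
      rw [inv_mul_eq_div, le_div_iff₀ hβ']
      refine le_of_sq_le_sq ?_ dist_nonneg
      rw [mul_pow, Real.sq_sqrt hβ.le, mul_comm]
      exact h1
    have hDc : ∀ i, CauchySeq fun k => (fieldGroup P hcont b).D i (κ k) := by
      intro i
      refine cauchySeq_of_dist_le (C := 1) hu' fun j k => ?_
      rw [one_mul, dist_eq_norm, ← D_sub ((hs j) i).1 ((hs k) i).1]
      refine le_of_sq_le_sq ?_ dist_nonneg
      rw [← hsum]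
      exact Finset.single_le_sum (f := fun i => ‖(fieldGroup P hcont b).D i (κ j - κ k)‖ ^ 2)
        (fun _ _ => sq_nonneg _) (Finset.mem_univ i)
    obtain ⟨κ₀, hκ₀⟩ := cauchySeq_tendsto_of_complete hκc
    choose δ hδ using fun i => cauchySeq_tendsto_of_complete (hDc i)
    -- Only potentials and their first derivatives converge; closedness of the generators puts the
    -- limit in `𝓗¹`, not necessarily in `𝓗²`.
    have hder := fun i => dom_of_tendsto (fun k => ((hs k) i).1) hκ₀ (hδ i)
    have hs₀ : Smooth1 hcont κ₀ := fun i => dom_of_hasDerivAt (hder i)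
    refine (mem_rangeOn (hcont := hcont)).2 ⟨κ₀, mem_fieldsH1_iff.2 ⟨?_, hs₀⟩, hs₀, ?_⟩
    · exact (isClosed_meanZero b).mem_of_tendsto hκ₀
        (Eventually.of_forall fun k => ((mem_H2 (hcont := hcont)).1 (hκ k)).1)
    · refine tendsto_nhds_unique ?_ hlim
      have : Tendsto (fun k => op hcont T (κ k)) atTop (𝓝 (op hcont T κ₀)) := by
        simp only [op, D_of_hasDerivAt (hder _)]
        exact tendsto_finsetSum _ fun i _ => ((cmap P (slice T i)).continuous.tendsto _).comp (hδ i)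
      simpa only [hκT] using this
  · obtain ⟨φ, hφ, hs, rfl⟩ := (mem_rangeOn (hcont := hcont)).1 hζ
    exact op_mem_rangeClosure T ((mem_fieldsH1_iff (hcont := hcont)).1 hφ).1 hs

variable (P) in
/-- The `j`-th component, as a scalar field. -/
def comp (j : Fin n) : Field P n →L[ℂ] Field P 1 := cmap P (Matrix.of fun _ => (Pi.single j 1 : Fin n → ℂ))

theorem comp_apply (j : Fin n) (ξ : Field P n) (k : Fin 1) : comp P j ξ k = ξ j := by
  rw [comp, cmap_apply, Finset.sum_eq_single j]
  · simp
  · intro k _ hk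
    simp [hk]
  · simp

theorem sum_norm_sq_comp (ξ : Field P n) : ∑ j, ‖comp P j ξ‖ ^ 2 = ‖ξ‖ ^ 2 := by
  rw [PiLp.norm_sq_eq_of_L2]
  refine Finset.sum_congr rfl fun j _ => ?_
  rw [PiLp.norm_sq_eq_of_L2]
  simp [comp_apply]

/-- A Poincaré inequality for scalar fields implies one for vector fields. -/
theorem poincare_of_scalar {β : ℝ} (h : ∀ φ : Field P 1, φ ∈ meanZero P 1 → Smooth2 hcont φ →
      β * ‖φ‖ ^ 2 ≤ ∑ i, ‖(fieldGroup P hcont 1).D i φ‖ ^ 2) (φ : Field P b)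
    (h0 : φ ∈ meanZero P b) (hs : Smooth2 hcont φ) :
    β * ‖φ‖ ^ 2 ≤ ∑ i, ‖(fieldGroup P hcont b).D i φ‖ ^ 2 := by
  have hc : ∀ j : Fin b, Intertwines (fieldGroup P hcont b) (fieldGroup P hcont 1) (comp P j) :=
    fun j => cmap_intertwines _
  simp only [← sum_norm_sq_comp (P := P) (n := b)]
  rw [Finset.mul_sum, Finset.sum_comm]
  refine Finset.sum_le_sum fun j _ => ?_
  refine (h _ (meanZero_of_intertwines (hc j) h0) (hs.of_intertwines (hc j))).trans_eq ?_
  refine Finset.sum_congr rfl fun i _ => ?_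
  rw [(hc j).D (hs i).1]

end Poincare

end Operators

/-! ### The concrete pairs for gradient and curl -/

section Symbols

theorem two_matrix_apply {n : ℕ} (r c : Fin n) :
    (2 : Matrix (Fin n) (Fin n) ℂ) r c = if r = c then 2 else 0 := by
  have h : (2 : Matrix (Fin n) (Fin n) ℂ) = 1 + 1 := one_add_one_eq_two.symm
  rw [h, Matrix.add_apply, Matrix.one_apply]
  split_ifs <;> norm_num

/-- The identities behind the entrywise check are `div curl = 0` and `curl curl - grad div = -Δ`. -/
theorem helmholtzPair_curl_three :
    HelmholtzPair (d := 3) (a := 3) (b := 1) (n := 3) (curlMatrix 3) (-(gradMatrix 3).transpose) := by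
  have hc : curlMatrix 3 = (!![0, -Pi.single 2 1, Pi.single 1 1;
      Pi.single 2 1, 0, -Pi.single 0 1; -Pi.single 1 1, Pi.single 0 1, 0] :
      Matrix (Fin 3) (Fin 3) (Fin 3 → ℂ)) := rfl
  constructor
  · intro i
    ext r c
    fin_cases i <;> fin_cases r <;> fin_cases c <;> simp [hc, slice]
  · intro i
    ext r c
    fin_cases i <;> fin_cases r <;> fin_cases c <;> simp [gradMatrix, slice]
  · intro i k
    ext r c
    fin_cases i <;> fin_cases k <;> fin_cases r <;> fin_cases c <;>
      simp [hc, gradMatrix, slice, Matrix.mul_apply, Fin.sum_univ_three]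
  · intro i k
    ext r c
    fin_cases i <;> fin_cases k <;> fin_cases r <;> fin_cases c <;>
      simp [hc, gradMatrix, slice, Matrix.mul_apply, Fin.sum_univ_three, two_matrix_apply] <;>
      norm_num

theorem helmholtzPair_curl_two :
    HelmholtzPair (d := 2) (a := 1) (b := 1) (n := 2) (curlMatrix 2) (-(gradMatrix 2).transpose) := by
  have hc : curlMatrix 2 = (!![-Pi.single 1 1, Pi.single 0 1] :
      Matrix (Fin 1) (Fin 2) (Fin 2 → ℂ)) := rfl
  constructor
  · intro i
    ext r c
    fin_cases i <;> fin_cases r <;> fin_cases c <;> simp [hc, slice]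
  · intro i
    ext r c
    fin_cases i <;> fin_cases r <;> fin_cases c <;> simp [gradMatrix, slice]
  · intro i k
    ext r c
    fin_cases i <;> fin_cases k <;> fin_cases r <;> fin_cases c <;>
      simp [hc, gradMatrix, slice, Matrix.mul_apply]
  · intro i k
    ext r c
    fin_cases i <;> fin_cases k <;> fin_cases r <;> fin_cases c <;>
      simp [hc, gradMatrix, slice, Matrix.mul_apply, two_matrix_apply] <;> norm_num

/-- On scalars `∇* ∇ = -Δ` already, so the partner is `0` and no gauge is needed. -/
theorem helmholtzPair_grad (d : ℕ) :
    HelmholtzPair (0 : Matrix (Fin 1) (Fin 1) (Fin d → ℂ)) (gradMatrix d) := by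
  have hz : ∀ i, slice (0 : Matrix (Fin 1) (Fin 1) (Fin d → ℂ)) i = 0 := fun i => rfl
  constructor
  · intro i
    simp [hz]
  · intro i
    ext r c
    by_cases h : i = c <;> simp [gradMatrix, slice, h]
  · intro i k
    simp [hz]
  · intro i k
    ext r c
    fin_cases r
    fin_cases c
    rcases eq_or_ne i k with rfl | h
    · simp [gradMatrix, slice, Matrix.mul_apply, two_matrix_apply]
      norm_num [Pi.single_apply]
    · simp [gradMatrix, slice, Matrix.mul_apply, h]
      simp [Pi.single_apply, h, h.symm]

theorem neg_transpose_curlMatrix_two :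
    (-(curlMatrix 2).transpose : Matrix (Fin 2) (Fin 1) (Fin 2 → ℂ)) =
      !![Pi.single 1 1; -Pi.single 0 1] := by
  have h : ∀ M : Matrix (Fin 1) (Fin 2) (Fin 2 → ℂ), M = curlMatrix 2 →
      -M.transpose = !![Pi.single 1 1; -Pi.single 0 1] := by
    intro M hM
    have hM' : M = !![-Pi.single 1 1, Pi.single 0 1] := hM
    rw [hM']
    ext1 i j
    fin_cases i <;> fin_cases j <;> simp
  exact h (curlMatrix 2) rfl

theorem helmholtzPair_gauge_two :
    HelmholtzPair (0 : Matrix (Fin 1) (Fin 1) (Fin 2 → ℂ))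
      (!![Pi.single 1 1; -Pi.single 0 1] : Matrix (Fin 2) (Fin 1) (Fin 2 → ℂ)) := by
  constructor
  · intro i
    simp [slice]
  · intro i
    ext r c
    fin_cases i <;> fin_cases r <;> fin_cases c <;> simp [slice]
  · intro i k
    simp [slice]
  · intro i k
    ext r c
    fin_cases i <;> fin_cases k <;> fin_cases r <;> fin_cases c <;>
      simp [slice, Matrix.mul_apply, two_matrix_apply] <;> norm_num

theorem helmholtzPair_curl {d : ℕ} (hd : d = 2 ∨ d = 3) :
    HelmholtzPair (curlMatrix d) (-(gradMatrix d).transpose) := by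
  rcases hd with rfl | rfl
  · exact helmholtzPair_curl_two
  · exact helmholtzPair_curl_three

theorem neg_transpose_curlMatrix_three :
    (-(curlMatrix 3).transpose : Matrix (Fin 3) (Fin 3) (Fin 3 → ℂ)) = curlMatrix 3 := by
  have h : ∀ M : Matrix (Fin 3) (Fin 3) (Fin 3 → ℂ), M = curlMatrix 3 → -M.transpose = M := by
    intro M hM
    have hM' : M = !![0, -Pi.single 2 1, Pi.single 1 1;
      Pi.single 2 1, 0, -Pi.single 0 1; -Pi.single 1 1, Pi.single 0 1, 0] := hM
    rw [hM']
    ext1 i j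
    fin_cases i <;> fin_cases j <;> simp
  exact h (curlMatrix 3) rfl

/-- In 2D the scalar potential satisfies `∇× (∇×)* = -Δ` without a gauge. In 3D the curl equals its
adjoint, and the divergence gauge is the other member of the curl pair. -/
theorem helmholtzPair_gauge {d : ℕ} (hd : d = 2 ∨ d = 3) :
    HelmholtzPair (gaugeMatrix d) (-(curlMatrix d).transpose) := by
  rcases hd with rfl | rfl
  · have := helmholtzPair_gauge_two
    rw [← neg_transpose_curlMatrix_two] at this
    exact this
  · have := helmholtzPair_curl_three.symm
    rw [← neg_transpose_curlMatrix_three] at this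
    exact this

end Symbols

/-! ### Random elliptic matrices and Lax–Milgram -/

section Coercive

variable {Ω : Type*} [MeasurableSpace Ω] {P : Measure Ω} {n : ℕ}

theorem memLp_mul {g : Ω → ℂ} (hg : Measurable g) {C : ℝ} (hC : ∀ ω, ‖g ω‖ ≤ C)
    (f : Lp ℂ 2 P) : MemLp (fun ω => g ω * f ω) 2 P :=
  (Lp.memLp f).of_le_mul (c := C) (hg.aestronglyMeasurable.mul (Lp.aestronglyMeasurable f))
    (Eventually.of_forall fun ω => by
      rw [norm_mul]
      exact mul_le_mul_of_nonneg_right (hC ω) (norm_nonneg _))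

variable (P) in
/-- Multiplication of a square integrable function by a bounded measurable one. -/
def mulLp (g : Ω → ℂ) (hg : Measurable g) (C : ℝ) (hC : ∀ ω, ‖g ω‖ ≤ C) :
    Lp ℂ 2 P →L[ℂ] Lp ℂ 2 P :=
  have hm := memLp_mul (P := P) hg hC
  LinearMap.mkContinuous
    { toFun := fun f => (hm f).toLp
      map_add' := fun f h => by
        refine Lp.ext ?_
        filter_upwards [(hm (f + h)).coeFn_toLp, (hm f).coeFn_toLp, (hm h).coeFn_toLp,
          Lp.coeFn_add f h, Lp.coeFn_add (hm f).toLp (hm h).toLp] with ω h1 h2 h3 h4 h5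
        rw [h1, h5, Pi.add_apply, h2, h3, h4, Pi.add_apply, mul_add]
      map_smul' := fun c f => by
        refine Lp.ext ?_
        filter_upwards [(hm (c • f)).coeFn_toLp, (hm f).coeFn_toLp,
          Lp.coeFn_smul c f, Lp.coeFn_smul c (hm f).toLp] with ω h1 h2 h3 h4
        rw [h1, RingHom.id_apply, h4, Pi.smul_apply, h2, h3, Pi.smul_apply, mul_smul_comm] } C
    (fun f => by
      refine Lp.norm_le_mul_norm_of_ae_le_mul ?_
      filter_upwards [(hm f).coeFn_toLp] with ω h
      simp only [LinearMap.coe_mk, AddHom.coe_mk]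
      rw [h, norm_mul]
      exact mul_le_mul_of_nonneg_right (hC ω) (norm_nonneg _))

theorem coeFn_mulLp (g : Ω → ℂ) (hg : Measurable g) (C : ℝ) (hC : ∀ ω, ‖g ω‖ ≤ C)
    (f : Lp ℂ 2 P) : (mulLp P g hg C hC f : Ω → ℂ) =ᵐ[P] fun ω => g ω * f ω :=
  MemLp.coeFn_toLp (memLp_mul hg hC f)

variable (P) in
/-- Multiplication by a bounded random matrix is a bounded operator on fields. -/
theorem exists_mulOp {A : Ω → Matrix (Fin n) (Fin n) ℝ} (hA : IsElliptic A) :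
    ∃ M : Field P n →L[ℂ] Field P n, ∀ ξ, MulEq P A ξ (M ξ) := by
  obtain ⟨K, hK⟩ := hA.bounded
  let g : Fin n → Fin n → Lp ℂ 2 P →L[ℂ] Lp ℂ 2 P := fun i j =>
    mulLp P (fun ω => (A ω i j : ℂ)) (Complex.measurable_ofReal.comp (hA.measurable i j)) K
      (fun ω => by simpa using hK ω i j)
  refine ⟨(PiLp.continuousLinearEquiv 2 ℂ (fun _ : Fin n => Lp ℂ 2 P)).symm.toContinuousLinearMap.comp
    (ContinuousLinearMap.pi fun i => ∑ j, (g i j).comp (proj P j)), fun ξ i => ?_⟩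
  have h1 : ((PiLp.continuousLinearEquiv 2 ℂ
      (fun _ : Fin n => Lp ℂ 2 P)).symm.toContinuousLinearMap.comp
      (ContinuousLinearMap.pi fun i => ∑ j, (g i j).comp (proj P j)) ξ) i = ∑ j, g i j (ξ j) := by
    simp
    rfl
  rw [h1]
  have h2 : ∀ j, (g i j (ξ j) : Ω → ℂ) =ᵐ[P] fun ω => (A ω i j : ℂ) * ξ j ω := fun j =>
    coeFn_mulLp _ _ _ _ _
  have h3 := Lp.coeFn_finsetSum (p := 2) (μ := P) Finset.univ fun j => g i j (ξ j)
  filter_upwards [h3, ae_all_iff.2 h2] with ω h3 h2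
  rw [h3, Finset.sum_apply]
  exact Finset.sum_congr rfl fun j _ => h2 j

theorem MulEq.unique {A : Ω → Matrix (Fin n) (Fin n) ℝ} {ξ η η' : Field P n}
    (h : MulEq P A ξ η) (h' : MulEq P A ξ η') : η = η' := by
  ext1 i
  exact Lp.ext ((h i).trans (h' i).symm)

/-- For a real matrix the real part of the sesquilinear form separates into real and imaginary parts
of `v`, so ellipticity on real vectors gives complex coercivity without symmetry of `A`. -/
theorem re_sum_conj_mul (A : Matrix (Fin n) (Fin n) ℝ) (v : Fin n → ℂ) :
    (∑ i, (∑ j, (A i j : ℂ) * v j) * starRingEnd ℂ (v i)).re =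
      A.mulVec (fun i => (v i).re) ⬝ᵥ (fun i => (v i).re) +
      A.mulVec (fun i => (v i).im) ⬝ᵥ (fun i => (v i).im) := by
  simp only [Matrix.mulVec, dotProduct, Complex.re_sum, ← Finset.sum_add_distrib, Complex.mul_re,
    Complex.im_sum, Complex.mul_im, Complex.conj_re, Complex.conj_im, Complex.ofReal_re,
    Complex.ofReal_im]
  refine Finset.sum_congr rfl fun i _ => ?_
  simp

theorem re_inner_mulEq {A : Ω → Matrix (Fin n) (Fin n) ℝ} {a : ℝ}
    (hA : ∀ (ω : Ω) (ξ : Fin n → ℝ), a * (ξ ⬝ᵥ ξ) ≤ (A ω).mulVec ξ ⬝ᵥ ξ)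
    {ξ η : Field P n} (h : MulEq P A ξ η) : a * ‖ξ‖ ^ 2 ≤ (inner ℂ ξ η).re := by
  have key : ∀ ζ : Field P n,
      (inner ℂ ξ ζ).re = ∫ ω, (∑ i, inner ℂ (ξ i ω) (ζ i ω)).re ∂P := by
    intro ζ
    have hint : Integrable (fun ω => ∑ i, inner ℂ (ξ i ω) (ζ i ω)) P :=
      integrable_finsetSum _ fun i _ => L2.integrable_inner (𝕜 := ℂ) (ξ i) (ζ i)
    have h1 : ∫ ω, (∑ i, inner ℂ (ξ i ω) (ζ i ω)).re ∂P =
        (∫ ω, ∑ i, inner ℂ (ξ i ω) (ζ i ω) ∂P).re := integral_re hint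
    rw [h1, integral_finsetSum _ fun i _ => L2.integrable_inner (𝕜 := ℂ) (ξ i) (ζ i),
      PiLp.inner_apply]
    simp only [L2.inner_def]
  have hint : ∀ ζ : Field P n, Integrable (fun ω => (∑ i, inner ℂ (ξ i ω) (ζ i ω)).re) P :=
    fun ζ => (integrable_finsetSum _ fun i _ =>
      L2.integrable_inner (𝕜 := ℂ) (ξ i) (ζ i)).re
  have h2 : ‖ξ‖ ^ 2 = (inner ℂ ξ ξ).re := by
    rw [inner_self_eq_norm_sq_to_K]
    norm_cast
  rw [h2, key, key, ← integral_const_mul]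
  refine integral_mono_ae ((hint ξ).const_mul a) (hint η) ?_
  filter_upwards [ae_all_iff.2 h] with ω hω
  have h3 : (∑ i, inner ℂ (ξ i ω) (ξ i ω)).re =
      (fun i => (ξ i ω).re) ⬝ᵥ (fun i => (ξ i ω).re) +
      (fun i => (ξ i ω).im) ⬝ᵥ (fun i => (ξ i ω).im) := by
    rw [Complex.re_sum, dotProduct, dotProduct, ← Finset.sum_add_distrib]
    refine Finset.sum_congr rfl fun i _ => ?_
    rw [RCLike.inner_apply]
    simp [Complex.mul_re]
  have h4 : (∑ i, inner ℂ (ξ i ω) (η i ω)).re =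
      (A ω).mulVec (fun i => (ξ i ω).re) ⬝ᵥ (fun i => (ξ i ω).re) +
      (A ω).mulVec (fun i => (ξ i ω).im) ⬝ᵥ (fun i => (ξ i ω).im) := by
    rw [← re_sum_conj_mul]
    simp only [hω]
    rfl
  simp only [h3, h4, mul_add]
  exact add_le_add (hA ω _) (hA ω _)

/-- Lax–Milgram for a random elliptic matrix on a closed space of fields. -/
theorem exists_unique_corrector {A : Ω → Matrix (Fin n) (Fin n) ℝ} (hA : IsElliptic A)
    (V : Submodule ℂ (Field P n)) [CompleteSpace V] (E₀ : Field P n) :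
    ∃ u ∈ V, (∃ J, MulEq P A (E₀ + u) J ∧ J ∈ Vᗮ) ∧
      ∀ u' ∈ V, (∃ J, MulEq P A (E₀ + u') J ∧ J ∈ Vᗮ) → u' = u := by
  obtain ⟨M, hM⟩ := exists_mulOp P hA
  obtain ⟨a, ha, hcoer⟩ := hA.elliptic
  have hre : ∀ ξ, a * ‖ξ‖ ^ 2 ≤ (inner ℂ ξ (M ξ)).re := fun ξ =>
    re_inner_mulEq (fun ω v => (hcoer ω v).1) (hM ξ)
  -- The compression of multiplication by `A` to `V` inherits coercivity. `J ∈ Vᗮ` means that its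
  -- projection to `V` vanishes, which is the equation `f u = -P_V (M E₀)`.
  let f : V →L[ℂ] V := V.orthogonalProjectionOnto.comp (M.comp V.subtypeL)
  have hf : IsUnit f := by
    refine ContinuousLinearMap.isUnit_of_forall_le_norm_inner_map f (c := ⟨a, ha.le⟩) ha fun u => ?_
    have h1 : inner ℂ (f u) u = inner ℂ (M u) (u : Field P n) := by
      exact Submodule.inner_orthogonalProjectionOnto_eq_of_mem_right u (M u)
    rw [h1, norm_inner_symm, mul_comm]
    exact (hre u).trans (Complex.re_le_norm _)
  obtain ⟨u, hu⟩ := ((ContinuousLinearMap.isUnit_iff_bijective).1 hf).2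
    (-V.orthogonalProjectionOnto (M E₀))
  refine ⟨u, u.2, ⟨M (E₀ + u), hM _, ?_⟩, ?_⟩
  · rw [← Submodule.orthogonalProjectionOnto_eq_zero_iff, _root_.map_add, _root_.map_add]
    change _ + f u = 0
    rw [hu, add_neg_cancel]
  · rintro u' hu' ⟨J, hJ, hJV⟩
    obtain rfl := hJ.unique (hM _)
    rw [← Submodule.orthogonalProjectionOnto_eq_zero_iff, _root_.map_add, _root_.map_add] at hJV
    have h2 : f ⟨u', hu'⟩ = f u := by
      rw [hu]
      exact eq_neg_of_add_eq_zero_right hJV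
    exact congrArg Subtype.val (((ContinuousLinearMap.isUnit_iff_bijective).1 hf).1 h2)

end Coercive

/-! ### Weak equations and the fluctuating fields -/

section Fields

variable {Ω : Type*} [MeasurableSpace Ω] {P : Measure Ω} {d : ℕ} [NeZero d]
  [AddAction (EuclideanSpace ℝ (Fin d)) Ω] [MeasurableConstVAdd (EuclideanSpace ℝ (Fin d)) Ω]
  [IsProbabilityMeasure P] [ErgodicVAdd (EuclideanSpace ℝ (Fin d)) Ω P]
  {hcont : ∀ f : Lp ℂ 2 P, Continuous fun x : EuclideanSpace ℝ (Fin d) => translate P x f}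
  {l m n : ℕ}

include hcont in
-- Test fields of any mean with one derivative and mean-zero fields with two generate the same
-- closed range, so weak equations become orthogonality statements.
theorem forall_inner_eq_zero_iff {M : Matrix (Fin m) (Fin n) (Fin d → ℂ)} {J : Field P m} :
    (∀ φ : (opMatrix P M).domain, inner ℂ (opMatrix P M φ) J = 0) ↔ J ∈ (rangeClosure P M)ᗮ := by
  constructor
  · intro h
    rw [mem_orthogonal_rangeClosure (hcont := hcont)]
    intro φ hφ
    have hs := ((mem_H2 (hcont := hcont)).1 hφ).2.smooth1
    have := h ⟨φ, mem_domain_opMatrix.2 hs⟩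
    rwa [opMatrix_apply (hcont := hcont)] at this
  · intro h φ
    rw [opMatrix_apply (hcont := hcont)]
    exact (Submodule.mem_orthogonal _ _).1 h _
      (op_mem_rangeClosure' M (mem_domain_opMatrix.1 φ.2))

include hcont in
theorem constField_mem_orthogonal (M : Matrix (Fin m) (Fin n) (Fin d → ℂ)) (c : Fin m → ℂ) :
    constField P c ∈ (rangeClosure P M)ᗮ := by
  rw [Submodule.mem_orthogonal']
  exact fun ξ hξ => mem_meanZero_iff.1 (rangeClosure_le_meanZero (hcont := hcont) M hξ) c

include hcont in
/-- Existence and uniqueness of the fluctuating field, for a pair of orthogonal operators. -/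
theorem exists_unique_field {M : Matrix (Fin m) (Fin n) (Fin d → ℂ)}
    {N : Matrix (Fin m) (Fin l) (Fin d → ℂ)} (hMN : rangeClosure P M ⟂ rangeClosure P N)
    {A : Ω → Matrix (Fin m) (Fin m) ℝ} (hA : IsElliptic A) (c : Fin m → ℂ) :
    ∃ u : Field P m, (u ∈ rangeClosure P M ∧ mean P u = 0 ∧
        ((∀ φ : (opMatrix P N).domain, inner ℂ (opMatrix P N φ) (constField P c + u) = 0) ∧
        (∃ J : Field P m, MulEq P A (constField P c + u) J ∧
          ∀ φ : (opMatrix P M).domain, inner ℂ (opMatrix P M φ) J = 0) ∧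
        mean P (constField P c + u) = c)) ∧
      ∀ u' : Field P m, u' ∈ rangeClosure P M → mean P u' = 0 →
        ((∀ φ : (opMatrix P N).domain, inner ℂ (opMatrix P N φ) (constField P c + u') = 0) ∧
        (∃ J : Field P m, MulEq P A (constField P c + u') J ∧
          ∀ φ : (opMatrix P M).domain, inner ℂ (opMatrix P M φ) J = 0) ∧
        mean P (constField P c + u') = c) → u' = u := by
  simp only [forall_inner_eq_zero_iff (hcont := hcont)]
  obtain ⟨u, hu, hJ, huniq⟩ := exists_unique_corrector hA (rangeClosure P M) (constField P c)
  have hu0 : mean P u = 0 := rangeClosure_le_meanZero (hcont := hcont) M hu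
  -- The weak constraint on the field itself is automatic: constants are orthogonal to every range,
  -- and `u` lies in a range orthogonal to that of `N`.
  refine ⟨u, ⟨hu, hu0, Submodule.add_mem _ (constField_mem_orthogonal (hcont := hcont) N c)
    (hMN hu), hJ, ?_⟩, fun u' hu' _ h => huniq u' hu' h.2.1⟩
  rw [mean_add, hu0, mean_constField, add_zero]

theorem mem_graph_starProjection {F : Type*} [NormedAddCommGroup F] [InnerProductSpace ℂ F]
    {V : Submodule ℂ F} [V.HasOrthogonalProjection] {u : F} (hu : u ∈ V) :
    (u, u) ∈ ((V.starProjection : F →ₗ[ℂ] F).toPMap ⊤).graph := by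
  rw [LinearPMap.mem_graph_iff]
  exact ⟨⟨u, trivial⟩, rfl, Submodule.starProjection_eq_self_iff.2 hu⟩

include hcont in
theorem kernel_zero_inf (k : ℕ) : fieldsH2 P d k ⊓
    kernel (opMatrix P (0 : Matrix (Fin 1) (Fin k) (Fin d → ℂ))) = fieldsH2 P d k := by
  refine inf_eq_left.2 fun φ hφ => (mem_kernel (hcont := hcont)).2
    ⟨((mem_H2 (hcont := hcont)).1 hφ).2.smooth1, Finset.sum_eq_zero fun i _ => ?_⟩
  exact cmap_zero _

include hcont in
-- The pair `(0, ∇)` turns `‖∇ φ‖²` into `∑ ‖L_i φ‖²`, a form that passes to vector potentials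
-- componentwise; one scalar inequality thus serves both ranges.
theorem rangeClosure_eq_rangeOn_of_poincare {z k : ℕ} {β : ℝ} (hβ : 0 < β)
    (h : ∀ φ : (grad P d).domain, (φ : Field P 1) ∈ fieldsH1 P d 1 →
      β * ‖(φ : Field P 1)‖ ^ 2 ≤ ‖grad P d φ‖ ^ 2)
    {T : Matrix (Fin m) (Fin k) (Fin d → ℂ)} {Z : Matrix (Fin z) (Fin k) (Fin d → ℂ)}
    (hZT : HelmholtzPair Z T) : rangeClosure P T = rangeOn (opMatrix P T) (fieldsH1 P d k) := by
  refine rangeClosure_eq_rangeOn (hcont := hcont) hZT hβ (poincare_of_scalar fun φ h0 hs => ?_)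
  rw [(helmholtzPair_grad d).sum_norm_sq hs]
  have h1 := h ⟨φ, mem_domain_opMatrix.2 hs.smooth1⟩
    ((mem_fieldsH1_iff (hcont := hcont)).2 ⟨h0, hs.smooth1⟩)
  have h2 : grad P d ⟨φ, mem_domain_opMatrix.2 hs.smooth1⟩ = op hcont (gradMatrix d) φ :=
    opMatrix_apply _
  rw [h2] at h1
  exact h1.trans (le_add_of_nonneg_left (sq_nonneg _))

end Fields

end Helmholtz
end

open Helmholtz in
theorem mainTheorem11 {d : ℕ} (hd : d = 2 ∨ d = 3)
    {Ω : Type*} [MeasurableSpace Ω] (P : Measure Ω) [IsProbabilityMeasure P]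
    [AddAction (EuclideanSpace ℝ (Fin d)) Ω] [MeasurableConstVAdd (EuclideanSpace ℝ (Fin d)) Ω]
    [ErgodicVAdd (EuclideanSpace ℝ (Fin d)) Ω P]
    (hcont : ∀ f : Lp ℂ 2 P, Continuous fun x : EuclideanSpace ℝ (Fin d) => translate P x f) :
    -- `𝓗_× = R(∇)`, `𝓗_• = R(∇×)` and `𝓗² = 𝓗_× ⊕ 𝓗_•`, as Hilbert spaces
    (curlFree P d = (rangeOn (grad P d) (fieldsH2 P d 1)).topologicalClosure ∧
      divFree P d = (rangeOn (curlAdj P d) (fieldsH2 P d (curlDim d))).topologicalClosure ∧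
      curlFree P d ⟂ divFree P d ∧
      curlFree P d ⊔ divFree P d = hilbertH2 P d) ∧
    -- with a Poincaré inequality the ranges are closed
    ((∃ β : ℝ, 0 < β ∧ ∀ φ : (grad P d).domain, (φ : Field P 1) ∈ fieldsH1 P d 1 →
        β * ‖(φ : Field P 1)‖ ^ 2 ≤ ‖grad P d φ‖ ^ 2) →
      curlFree P d = rangeOn (grad P d) (fieldsH1 P d 1) ∧
      divFree P d = rangeOn (curlAdj P d) (fieldsH1 P d (curlDim d))) ∧
    -- `Γ` is well defined and is the orthogonal projection onto `𝓗_×`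
    (LinearMap.ker ((pcomp (gradAdj P d) (grad P d)).domRestrict (fieldsH2 P d 1)).toFun = ⊥ ∧
      Dense ((Gam P d).domain : Set (Field P d)) ∧
      (Gam P d).closure = ((curlFree P d).starProjection : Field P d →ₗ[ℂ] Field P d).toPMap ⊤) ∧
    -- `Υ` is well defined and is the orthogonal projection onto `𝓗_•`
    (LinearMap.ker ((pcomp (curl P d) (curlAdj P d)).domRestrict (curlPotentials P d)).toFun = ⊥ ∧
      Dense ((Ups P d).domain : Set (Field P d)) ∧
      (Ups P d).closure = ((divFree P d).starProjection : Field P d →ₗ[ℂ] Field P d).toPMap ⊤) ∧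
    -- the electric field
    (∀ σ : Ω → Matrix (Fin d) (Fin d) ℝ, IsElliptic σ → ∀ E₀ : Fin d → ℂ,
      (constField P E₀, 0) ∈ (Gam P d).graph ∧
      ∃ Ef : Field P d,
        (Ef ∈ curlFree P d ∧ mean P Ef = 0 ∧ SolvesE P d σ E₀ (constField P E₀ + Ef)) ∧
        (∀ Ef' : Field P d, Ef' ∈ curlFree P d → mean P Ef' = 0 →
          SolvesE P d σ E₀ (constField P E₀ + Ef') → Ef' = Ef) ∧
        (Ef, Ef) ∈ (Gam P d).closure.graph) ∧
    -- the current field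
    (∀ ρ : Ω → Matrix (Fin d) (Fin d) ℝ, IsElliptic ρ → ∀ J₀ : Fin d → ℂ,
      (constField P J₀, 0) ∈ (Ups P d).graph ∧
      ∃ Jf : Field P d,
        (Jf ∈ divFree P d ∧ mean P Jf = 0 ∧ SolvesJ P d ρ J₀ (constField P J₀ + Jf)) ∧
        (∀ Jf' : Field P d, Jf' ∈ divFree P d → mean P Jf' = 0 →
          SolvesJ P d ρ J₀ (constField P J₀ + Jf') → Jf' = Jf) ∧
        (Jf, Jf) ∈ (Ups P d).closure.graph) := by
  have : NeZero d := ⟨by omega⟩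
  have hAB := helmholtzPair_curl hd
  have hgrad := helmholtzPair_grad d
  have hgauge := helmholtzPair_gauge hd
  have hT : -(-(gradMatrix d).transpose).transpose = gradMatrix d :=
    neg_transpose_neg_transpose _
  have hcf : curlFree P d = rangeClosure P (gradMatrix d) := by
    have := hAB.closure_kernel (hcont := hcont)
    rwa [hT] at this
  have hdf : divFree P d = rangeClosure P (-(curlMatrix d).transpose) :=
    hAB.symm.closure_kernel (hcont := hcont)
  have horth : rangeClosure P (gradMatrix d) ⟂ rangeClosure P (-(curlMatrix d).transpose) := by
    have := hAB.symm.orthogonal (hcont := hcont)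
    rwa [hT] at this
  have hsup := hAB.symm.sup_eq (hcont := hcont)
  rw [hT] at hsup
  have hΓker := ker_pcomp_eq_bot (hcont := hcont) hAB hgrad hT
  have hΓdense := dense_domain_projOp (hcont := hcont) hAB hgrad hT
  have hΓclosure := closure_projOp (hcont := hcont) hAB hgrad hT
  have hΓconst := constField_mem_graph_projOp (hcont := hcont) hAB hgrad hT
  -- The general statements carry a gauge subspace; for `Γ` the gauge operator is `0` and the
  -- subspace is all of `𝓗²`.
  rw [kernel_zero_inf (hcont := hcont)] at hΓker hΓdense hΓclosure hΓconst
  have hΥclosure : (Ups P d).closure = ((rangeClosure P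
      (-(curlMatrix d).transpose)).starProjection : Field P d →ₗ[ℂ] Field P d).toPMap ⊤ :=
    closure_projOp (hcont := hcont) hAB.symm hgauge rfl
  have hΓclosure' : (Gam P d).closure = ((rangeClosure P
      (gradMatrix d)).starProjection : Field P d →ₗ[ℂ] Field P d).toPMap ⊤ := hΓclosure
  refine ⟨⟨hcf, hdf, ?_, ?_⟩, ?_, ⟨hΓker, hΓdense, ?_⟩,
    ⟨ker_pcomp_eq_bot (hcont := hcont) hAB.symm hgauge rfl,
      dense_domain_projOp (hcont := hcont) hAB.symm hgauge rfl, ?_⟩, ?_, ?_⟩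
  · rw [hcf, hdf]
    exact horth
  · rw [hcf, hdf, hsup]
    exact (hilbert_eq_meanZero (hcont := hcont) d).symm
  · rintro ⟨β, hβ, h⟩
    rw [hcf, hdf]
    exact ⟨rangeClosure_eq_rangeOn_of_poincare (hcont := hcont) hβ h hgrad,
      rangeClosure_eq_rangeOn_of_poincare (hcont := hcont) hβ h hgauge⟩
  · simp only [hcf]
    exact hΓclosure'
  · simp only [hdf]
    exact hΥclosure
  · intro σ hσ E₀
    obtain ⟨u, h1, h2⟩ := exists_unique_field (hcont := hcont) horth hσ E₀
    rw [hcf, hΓclosure']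
    exact ⟨hΓconst E₀, u, h1, h2, mem_graph_starProjection h1.1⟩
  · intro ρ hρ J₀
    -- The current problem is the electric one with the two orthogonal ranges exchanged.
    obtain ⟨u, h1, h2⟩ := exists_unique_field (hcont := hcont) horth.symm hρ J₀
    rw [hdf, hΥclosure]
    exact ⟨constField_mem_graph_projOp (hcont := hcont) hAB.symm hgauge rfl J₀, u, h1, h2,
      mem_graph_starProjection h1.1⟩
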